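/- **Setting.** Let $G=(V,E)$ be a finite directed graph with $n=|V|\ge 1$ nodes and a triggering model: each node $v$ independently samples a triggering set $T_v$ of in-neighbours from a distribution $D_v$; given a seed set $S$, a node becomes active one step after some node of its triggering set is active, and stays active; $\sigma(S)$ is the expected final number of active nodes. Let $\mathcal D\subseteq\mathbb R_+^d$ be convex, and let $q_{v,j}:\mathbb R_+\to[0,1]$ ($v\in V$, $j\in[d]$) be nondecreasing, concave and $L_q$-Lipschitz. A strategy mix $x\in\mathcal D$ activates each node $v$ as a seed, independently, with probability $h_v(x)=1-\prod_{j}(1-q_{v,j}(x_j))$ (independent strategy activation), and $g(x)=\sum_{S\subseteq V}\sigma(S)\prod_{u\in S}h_u(x)\prod_{v\notin S}(1-h_v(x))$. Let $c:\mathcal D\to\mathbb R$ be convex and $L_c$-Lipschitz, $k\ge0$, $\lambda\ge0$, $s(x)=\lambda(k-c(x))$, and $\mathcal P=\{x\in\mathcal D: c(x)\le k\}$. Assume that $\mathcal P$ is non-empty and closed and has diameter at most $\Delta$, and that $\mathrm{OPT}_{g+s}=\max_{x\in\mathcal P}(g+s)(x)\ge 1$. A random RR set is the set of nodes that reach a uniformly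 random root in the graph of edges $\{(w,u): w\in T_u\}$, for sampled $(T_u)_u$. $\mathcal N(\mathcal P,r)$ is the least size of a finite set within distance $r$ of every point of $\mathcal P$. For a sequence $\mathcal R$ of $\theta$ RR sets let $$\hat g_{\mathcal R}(x)=\frac n\theta\sum_{R\in\mathcal R}\Bigl(1-\prod_{v\in R}(1-h_v(x))\Bigr),\qquad \bar g_{\mathcal R}(x)=\frac n\theta\sum_{R\in\mathcal R}\min\Bigl\{1,\sum_{v\in R,\,j\in[d]}q_{v,j}(x_j)\Bigr\},$$ $\nu^{(1)}(\mathcal R)=\frac1\theta\sum_{R\in\mathcal R}|R|$, $L(\mathcal R)=\nu^{(1)}(\mathcal R)\,n\sqrt d\,L_q+\lambda L_c$. **Gradient algorithm** $\mathcal A(\mathcal R,\delta)$. Run $T=\lceil 9(\Delta L(\mathcal R))^2/\delta^2\rceil$ steps of projected subgradient ascent on $\bar g_{\mathcal R}+s$ over $\mathcal P$ from a given $x_0\in\mathcal P$, with step sizes $\eta_t=\Delta/(L(\mathcal R)\sqrt t)$, $t=1,\dots,T$, and return the best of the $T+1$ iterates with respect to $\bar g_{\mathcal R}+s$. The subgradient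 used at $x$ is $\frac n\theta\sum_{R}u_R-\lambda\,\partial c(x)$, where $u_R=0$ if $\sum_{v\in R,j}q_{v,j}(x_j)\ge1$ and $u_R=\bigl(\sum_{v\in R}q_{v,j}'(x_j)\bigr)_j$ otherwise; here $q_{v,j}'$ and $\partial c$ are arbitrary selections of supergradients of $q_{v,j}$ and subgradients of $c$, bounded in norm by $L_q$ and $L_c$. **UpperGrad-RIS.** Let $\alpha=1-1/e$, $\alpha'=\alpha-\varepsilon/3$, $\varepsilon'=\sqrt2\,\varepsilon/3$, $L_1=L_2=n^2\sqrt d\,L_q+\lambda L_c$. Start with $LB=1$. For $i=1,2,\dots,\lfloor\log_2(n+\lambda k)-1\rfloor$: let $x_i=(n+\lambda k)/2^i$ and $$\theta_i=\Bigl\lceil n\bigl(2+\tfrac23\varepsilon'\bigr)\frac{\ln\mathcal N(\mathcal P,\frac{\varepsilon/3}{L_2}x_i)+\ell\ln n+\ln2+\ln\log_2(n+\lambda k)}{\varepsilon'^2x_i}\Bigr\rceil;$$ extend the current sequence of independent random RR sets to a sequence $\mathcal R_i$ of length $\theta_i$, and let $y_i=\mathcal A(\mathcal R_i,\varepsilon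 x_i/3)$; if $(\hat g_{\mathcal R_i}+s)(y_i)\ge(1+\varepsilon'+\varepsilon/3)x_i$, set $LB=(\hat g_{\mathcal R_i}+s)(y_i)/(1+\varepsilon'+\varepsilon/3)$ and leave the loop. Then let $$\theta^{(1)}=\frac{8n\ln(4n^\ell)}{LB\,(\alpha-\varepsilon/3)^2\varepsilon^2/9},\qquad \theta^{(2)}=\frac{2\alpha' n\ln\bigl(4n^\ell\,\mathcal N(\mathcal P,\frac{\varepsilon/3}{L_1+L_2}LB)\bigr)}{\bigl(\varepsilon/3-\frac14(\alpha-\varepsilon/3)^2\varepsilon/3\bigr)^2LB},$$ generate a sequence $\mathcal R$ of $\lceil\max\{\theta^{(1)},\theta^{(2)}\}\rceil$ fresh independent random RR sets, and output $x=\mathcal A(\mathcal R,\varepsilon\,LB)$. **Theorem.** For all $\varepsilon,\ell>0$, with probability at least $1-\frac1{n^\ell}$, UpperGrad-RIS outputs $x\in\mathcal P$ with $$(g+s)(x)\ \ge\ \Bigl(1-\frac1e-\varepsilon\Bigr)\,\mathrm{OPT}_{g+s}.$$ (Quotients by $0$ in degenerate cases are read as $0$, and so is the logarithm of an infinite covering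 number, which only occurs when $L_1=L_2=0$; a negative number of RR sets is read as $0$.) -/

import Mathlib

open MeasureTheory ProbabilityTheory

open scoped NNReal ENNReal

/-- A social network with its triggering model: every node `v` has a probability distribution
`D v` on the sets of in-neighbours of `v`. -/
structure TriggeringModel (V : Type*) where
  /-- the social network -/
  graph : Digraph V
  /-- the distribution of the triggering set of a node -/
  D : V → PMF (Finset V)
  /-- triggering sets consist of in-neighbours -/
  adj_of_mem_support : ∀ v, ∀ T ∈ (D v).support, ∀ u ∈ T, graph.Adj u v

namespace TriggeringModel

section
variable {V : Type*} [Fintype V]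

open Classical in
theorem sum_prod_D (M : TriggeringModel V) :
    ∑ T : V → Finset V, ∏ v, M.D v (T v) = 1 := by
  have h := Finset.prod_univ_sum (fun _ : V => (Finset.univ : Finset (Finset V)))
    (fun v A => M.D v A)
  rw [Fintype.piFinset_univ] at h
  rw [← h]
  refine Finset.prod_eq_one fun v _ => ?_
  have h1 := (M.D v).tsum_coe
  rwa [tsum_fintype] at h1

open Classical in
/-- The joint law of the triggering sets `(T v)_v`: they are sampled independently. -/
noncomputable def triggerLaw (M : TriggeringModel V) : PMF (V → Finset V) :=
  PMF.ofFintype (fun T => ∏ v, M.D v (T v)) M.sum_prod_D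

open Classical in
/-- The nodes that are active at time `t`, when the seeds are `S` and the sampled triggering
sets are `T`: an active node stays active, and `v` gets activated at time `t + 1` if some node of
`T v` is active at time `t`. -/
noncomputable def activeAt (T : V → Finset V) (S : Finset V) : ℕ → Finset V
  | 0 => S
  | t + 1 => activeAt T S t ∪
      Finset.univ.filter fun v => ∃ u ∈ T v, u ∈ activeAt T S t

open Classical in
/-- The nodes that are active in the end. -/
noncomputable def finalActive (T : V → Finset V) (S : Finset V) : Finset V :=
  Finset.univ.filter fun v => ∃ t, v ∈ activeAt T S t

open Classical in
/-- The influence spread `σ(S)`: the expected number of nodes that are active in the end. -/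
noncomputable def spread (M : TriggeringModel V) (S : Finset V) : ℝ :=
  ∑ T : V → Finset V, (M.triggerLaw T).toReal * ((finalActive T S).card : ℝ)

open Classical in
/-- The nodes that can reach `v` in the live-edge graph `{(w, u) | w ∈ T u}`. -/
noncomputable def reverseReachable (T : V → Finset V) (v : V) : Finset V :=
  Finset.univ.filter fun u => Relation.ReflTransGen (fun w u' => w ∈ T u') u v

/-- The law of a random reverse reachable (RR) set: the root is uniform on `V`, and the triggering
sets are sampled independently of the root. -/
noncomputable def rrLaw [Nonempty V] (M : TriggeringModel V) : PMF (Finset V) :=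
  (PMF.uniformOfFintype V).bind fun v => M.triggerLaw.map fun T => reverseReachable T v

end

end TriggeringModel

/-- An instance of continuous influence maximization with budget saving, in the case of
independent strategy activation, with `d` marketing strategies. -/
structure CIMBS (V : Type*) (d : ℕ) where
  /-- the social network and its triggering model -/
  model : TriggeringModel V
  /-- strategy `j` with amount `a` activates `v` as a seed with probability `q v j a` -/
  q : V → Fin d → ℝ → ℝ
  q_mem : ∀ v j, ∀ a ∈ Set.Ici (0 : ℝ), q v j a ∈ Set.Icc (0 : ℝ) 1
  q_mono : ∀ v j, MonotoneOn (q v j) (Set.Ici 0)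
  q_concave : ∀ v j, ConcaveOn ℝ (Set.Ici 0) (q v j)
  /-- the domain of the strategy mixes -/
  domain : Set (EuclideanSpace ℝ (Fin d))
  domain_nonneg : ∀ x ∈ domain, ∀ j, 0 ≤ x j
  domain_convex : Convex ℝ domain
  /-- the cost function -/
  cost : EuclideanSpace ℝ (Fin d) → ℝ
  cost_convex : ConvexOn ℝ domain cost
  /-- the total budget `k` -/
  budget : ℝ
  budget_nonneg : 0 ≤ budget
  /-- the balance parameter `λ` -/
  lam : ℝ
  lam_nonneg : 0 ≤ lam

namespace CIMBS

section
variable {V : Type*} [Fintype V] {d : ℕ}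

/-- The feasible set `P = {x ∈ domain | c(x) ≤ k}`. -/
def feasible (I : CIMBS V d) : Set (EuclideanSpace ℝ (Fin d)) :=
  {x | x ∈ I.domain ∧ I.cost x ≤ I.budget}

/-- The strategy activation function `h_v(x) = 1 - ∏_j (1 - q_{v,j}(x_j))`. -/
noncomputable def h (I : CIMBS V d) (v : V) (x : EuclideanSpace ℝ (Fin d)) : ℝ :=
  1 - ∏ j, (1 - I.q v j (x j))

open Classical in
/-- The influence spread of a strategy mix:
`g(x) = ∑_{S ⊆ V} σ(S) ∏_{u ∈ S} h_u(x) ∏_{v ∉ S} (1 - h_v(x))`. -/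
noncomputable def g (I : CIMBS V d) (x : EuclideanSpace ℝ (Fin d)) : ℝ :=
  ∑ S : Finset V, I.model.spread S * (∏ u ∈ S, I.h u x) * ∏ v ∈ Sᶜ, (1 - I.h v x)

/-- The budget saving `s(x) = λ (k - c(x))`. -/
def s (I : CIMBS V d) (x : EuclideanSpace ℝ (Fin d)) : ℝ :=
  I.lam * (I.budget - I.cost x)

/-- `OPT_{g+s}`, the optimal value of `g + s` on the feasible set. -/
noncomputable def opt (I : CIMBS V d) : ℝ :=
  sSup ((fun x => I.g x + I.s x) '' I.feasible)

/-! A collection of `θ` RR sets is given as the first `θ` terms of a sequence `R`. -/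

/-- `ĝ_R(x) = (n/θ) ∑_{R} (1 - ∏_{v ∈ R} (1 - h_v(x)))`. -/
noncomputable def gHat (I : CIMBS V d) (R : ℕ → Finset V) (θ : ℕ)
    (x : EuclideanSpace ℝ (Fin d)) : ℝ :=
  (Fintype.card V : ℝ) / θ * ∑ i ∈ Finset.range θ, (1 - ∏ v ∈ R i, (1 - I.h v x))

/-- The concave upper bound `ḡ_R(x) = (n/θ) ∑_{R} min {1, ∑_{v ∈ R, j} q_{v,j}(x_j)}`. -/
noncomputable def gBar (I : CIMBS V d) (R : ℕ → Finset V) (θ : ℕ)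
    (x : EuclideanSpace ℝ (Fin d)) : ℝ :=
  (Fintype.card V : ℝ) / θ *
    ∑ i ∈ Finset.range θ, min 1 (∑ v ∈ R i, ∑ j, I.q v j (x j))

end

/-- The inputs of the algorithm besides the instance itself. -/
structure Input (V : Type*) (d : ℕ) where
  /-- Lipschitz constant of the functions `q v j` -/
  Lq : ℝ≥0
  /-- Lipschitz constant of the cost function -/
  Lc : ℝ≥0
  /-- upper bound of the diameter of the feasible set -/
  Δ : ℝ
  /-- approximation parameter -/
  ε : ℝ
  /-- confidence parameter -/
  ℓ : ℝ
  /-- starting point of the subgradient method -/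
  x₀ : EuclideanSpace ℝ (Fin d)
  /-- supergradients of the functions `q v j` (their derivatives, where these exist) -/
  dq : V → Fin d → ℝ → ℝ
  /-- subgradients of the cost function (its gradient, where it exists) -/
  dc : EuclideanSpace ℝ (Fin d) → EuclideanSpace ℝ (Fin d)

/-- The inputs are as they should be for the instance `I`. The (super-, sub-)gradients can be any;
only, as for gradients, their norms are bounded by the Lipschitz constants. (In the interior of
the domain, this holds for all of them; at a boundary point, where there are arbitrarily large
ones, it says which of them may be used, and there always is one.) -/
structure Input.Valid {V : Type*} {d : ℕ} (p : Input V d) (I : CIMBS V d) : Prop where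
  q_lipschitz : ∀ v j, LipschitzOnWith p.Lq (I.q v j) (Set.Ici 0)
  cost_lipschitz : LipschitzOnWith p.Lc I.cost I.domain
  dist_le : ∀ x ∈ I.feasible, ∀ y ∈ I.feasible, dist x y ≤ p.Δ
  ε_pos : 0 < p.ε
  ℓ_pos : 0 < p.ℓ
  x₀_mem : p.x₀ ∈ I.feasible
  dq_super : ∀ v j, ∀ a ∈ Set.Ici (0 : ℝ), ∀ b ∈ Set.Ici (0 : ℝ),
    I.q v j b ≤ I.q v j a + p.dq v j a * (b - a)
  dq_bound : ∀ v j, ∀ a ∈ Set.Ici (0 : ℝ), |p.dq v j a| ≤ p.Lq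
  dc_sub : ∀ x ∈ I.domain, ∀ y ∈ I.domain, I.cost x + inner ℝ (p.dc x) (y - x) ≤ I.cost y
  dc_bound : ∀ x ∈ I.domain, ‖p.dc x‖ ≤ p.Lc

section
variable {V : Type*} [Fintype V] {d : ℕ}

/-- A point of `P` that is nearest to `y` (it is unique when `P` is closed, convex and
non-empty). -/
noncomputable def proj (P : Set (EuclideanSpace ℝ (Fin d))) (y : EuclideanSpace ℝ (Fin d)) :
    EuclideanSpace ℝ (Fin d) :=
  Classical.epsilon fun z => z ∈ P ∧ ∀ w ∈ P, dist y z ≤ dist y w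

/-- The subgradient of `ḡ_R + s` at `x` that the algorithm uses: an RR set `R` contributes `0` to
the part for `ḡ_R` if `∑_{v ∈ R, j} q_{v,j}(x_j) ≥ 1`, and `∑_{v ∈ R, j} ∇ q_{v,j}(x_j)`
otherwise. -/
noncomputable def subgrad (I : CIMBS V d) (p : Input V d) (R : ℕ → Finset V) (θ : ℕ)
    (x : EuclideanSpace ℝ (Fin d)) : EuclideanSpace ℝ (Fin d) :=
  ((Fintype.card V : ℝ) / θ) • (∑ i ∈ Finset.range θ,
      if 1 ≤ ∑ v ∈ R i, ∑ j, I.q v j (x j) then 0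
      else WithLp.toLp 2 fun j => ∑ v ∈ R i, p.dq v j (x j))
    - I.lam • p.dc x

/-- The average size `ν⁽¹⁾(R)` of the RR sets. -/
noncomputable def avgSize (R : ℕ → Finset V) (θ : ℕ) : ℝ :=
  (∑ i ∈ Finset.range θ, ((R i).card : ℝ)) / θ

/-- The Lipschitz constant `ν⁽¹⁾(R) n √d L_q + λ L_c` of `ḡ_R + s`. -/
noncomputable def lipBar (I : CIMBS V d) (p : Input V d) (R : ℕ → Finset V) (θ : ℕ) : ℝ :=
  avgSize R θ * Fintype.card V * √d * p.Lq + I.lam * p.Lc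

/-- The iterates of the projected subgradient method for `ḡ_R + s` on the feasible set, with
step sizes `η_t = Δ / (L √t)` for `t = 1, 2, …`, where `L` is the Lipschitz constant. -/
noncomputable def iterate (I : CIMBS V d) (p : Input V d) (R : ℕ → Finset V) (θ : ℕ) :
    ℕ → EuclideanSpace ℝ (Fin d)
  | 0 => p.x₀
  | t + 1 => proj I.feasible (iterate I p R θ t +
      (p.Δ / (lipBar I p R θ * √((t : ℝ) + 1))) • subgrad I p R θ (iterate I p R θ t))

open Classical in
/-- The best of the iterates up to time `t`, with respect to `ḡ_R + s`. -/
noncomputable def best (I : CIMBS V d) (p : Input V d) (R : ℕ → Finset V) (θ : ℕ) :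
    ℕ → EuclideanSpace ℝ (Fin d)
  | 0 => iterate I p R θ 0
  | t + 1 =>
      if I.gBar R θ (best I p R θ t) + I.s (best I p R θ t)
          < I.gBar R θ (iterate I p R θ (t + 1)) + I.s (iterate I p R θ (t + 1))
      then iterate I p R θ (t + 1) else best I p R θ t

/-- The gradient algorithm: projected subgradient ascent on `ḡ_R + s`, with error parameter `δ`,
that is, with `T = ⌈9 (Δ L)² / δ²⌉` iterations. -/
noncomputable def upperGrad (I : CIMBS V d) (p : Input V d) (R : ℕ → Finset V) (θ : ℕ)
    (δ : ℝ) : EuclideanSpace ℝ (Fin d) :=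
  best I p R θ ⌈9 * (p.Δ * lipBar I p R θ) ^ 2 / δ ^ 2⌉₊

/-- The approximation ratio `α = 1 - 1/e` of the gradient algorithm. -/
noncomputable def ratio : ℝ := 1 - 1 / Real.exp 1

/-- The Lipschitz constants `L₁ = L₂ = n² √d L_q + λ L_c` of `g + s` and `ĝ_R + s`. -/
noncomputable def lip (I : CIMBS V d) (p : Input V d) : ℝ :=
  (Fintype.card V : ℝ) ^ 2 * √d * p.Lq + I.lam * p.Lc

/-- The covering number `𝒩(P, r)` of the feasible set. -/
noncomputable def covering (I : CIMBS V d) (r : ℝ) : ℝ :=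
  ((Metric.externalCoveringNumber r.toNNReal I.feasible).toNat : ℝ)

/-- `ε' = √2 ε / 3`. -/
noncomputable def epsPrime (p : Input V d) : ℝ := √2 * p.ε / 3

/-- The `i`-th guess `x_i = (n + λ k) / 2^i` of the optimal value. -/
noncomputable def guess (I : CIMBS V d) (i : ℕ) : ℝ :=
  ((Fintype.card V : ℝ) + I.lam * I.budget) / 2 ^ i

/-- The number `θ_i` of RR sets in the `i`-th round of the sampling phase. -/
noncomputable def theta (I : CIMBS V d) (p : Input V d) (i : ℕ) : ℕ :=
  ⌈(Fintype.card V : ℝ) * (2 + 2 / 3 * epsPrime p) *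
    (Real.log (I.covering (p.ε / 3 / lip I p * I.guess i)) + p.ℓ * Real.log (Fintype.card V) +
      Real.log 2 + Real.log (Real.logb 2 ((Fintype.card V : ℝ) + I.lam * I.budget))) /
    (epsPrime p ^ 2 * I.guess i)⌉₊

/-- The value of `ĝ_{R_i} + s` at the output of the gradient algorithm in round `i`, which is
called with the first `θ_i` RR sets of `R` (`θ_i - θ_{i-1}` of them are new) and with error
parameter `ε x_i / 3`. -/
noncomputable def roundValue (I : CIMBS V d) (p : Input V d) (R : ℕ → Finset V) (i : ℕ) : ℝ :=
  I.gHat R (theta I p i) (upperGrad I p R (theta I p i) (p.ε * I.guess i / 3)) +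
    I.s (upperGrad I p R (theta I p i) (p.ε * I.guess i / 3))

open Classical in
/-- The rounds `i, i + 1, …, i + m - 1` of the sampling phase: it stops at the first round that
passes the test, and `LB = 1` if there is none. -/
noncomputable def samplingLoop (I : CIMBS V d) (p : Input V d) (R : ℕ → Finset V) :
    (m i : ℕ) → ℝ
  | 0, _ => 1
  | m + 1, i =>
      if (1 + epsPrime p + p.ε / 3) * I.guess i ≤ roundValue I p R i
      then roundValue I p R i / (1 + epsPrime p + p.ε / 3)
      else samplingLoop I p R m (i + 1)

/-- The estimated lower bound `LB` after the rounds `i = 1, …, ⌊log₂(n + λ k) - 1⌋`. -/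
noncomputable def lowerBound (I : CIMBS V d) (p : Input V d) (R : ℕ → Finset V) : ℝ :=
  samplingLoop I p R
    ⌊Real.logb 2 ((Fintype.card V : ℝ) + I.lam * I.budget) - 1⌋₊ 1

/-- `θ⁽¹⁾ = 8 n ln(4 n^ℓ) / (LB (α - ε/3)² ε²/9)`. -/
noncomputable def theta1 (_I : CIMBS V d) (p : Input V d) (LB : ℝ) : ℝ :=
  8 * (Fintype.card V : ℝ) * Real.log (4 * (Fintype.card V : ℝ) ^ p.ℓ) /
    (LB * (ratio - p.ε / 3) ^ 2 * p.ε ^ 2 / 9)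

/-- `θ⁽²⁾ = 2 α' n ln(4 n^ℓ 𝒩(P, (ε/3) LB / (L₁ + L₂))) / ((ε/3 - (α - ε/3)² (ε/3) / 4)² LB)`,
where `α' = α - ε/3`. -/
noncomputable def theta2 (I : CIMBS V d) (p : Input V d) (LB : ℝ) : ℝ :=
  2 * (ratio - p.ε / 3) * (Fintype.card V : ℝ) *
    Real.log (4 * (Fintype.card V : ℝ) ^ p.ℓ *
      I.covering (p.ε / 3 / (lip I p + lip I p) * LB)) /
    ((p.ε / 3 - 1 / 4 * (ratio - p.ε / 3) ^ 2 * (p.ε / 3)) ^ 2 * LB)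

/-- The final number of RR sets, `max {θ⁽¹⁾, θ⁽²⁾}`, rounded up. -/
noncomputable def thetaFinal (I : CIMBS V d) (p : Input V d) (LB : ℝ) : ℕ :=
  ⌈max (theta1 I p LB) (theta2 I p LB)⌉₊

/-- The output of UpperGrad-RIS. The sampling phase uses RR sets from the sequence `R`; then
fresh RR sets, from the sequence `R'`, are generated, and the gradient algorithm is called with
them and with error parameter `ε LB`. -/
noncomputable def upperGradRIS (I : CIMBS V d) (p : Input V d) (R R' : ℕ → Finset V) :
    EuclideanSpace ℝ (Fin d) :=
  upperGrad I p R' (thetaFinal I p (lowerBound I p R)) (p.ε * lowerBound I p R)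

end

end CIMBS

/-
A random RR set `A` satisfies `g x = n * E (hitProb A x)`, so that `ĝ_R` is an unbiased estimator
of `g`. Since `(1 - 1/e) * min 1 t ≤ 1 - exp (-t)`, the estimator lies between `(1 - 1/e) * ḡ_R` and
`ḡ_R`. The surrogate `ḡ_R + s` is concave, and the regret bound of projected subgradient ascent
shows that `A(R, δ)` maximizes it up to `δ`, hence `ĝ_R + s` up to the factor `1 - 1/e` and the
additive error `δ`.

As the output of the algorithm depends on `R`, the concentration of `ĝ_R` is applied to the points
of a finite net of `P` and transferred to all of `P` by the Lipschitz bounds. In the sampling phase,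
Bernstein's inequality shows that `LB` exceeds the optimum with probability at most `1 / (2 n^ℓ)`.
The RR sets of the last phase are independent of `LB`, which takes finitely many values; for each
value not exceeding the optimum, the lower tail at a maximizer and the upper tail on a net show that
the output is bad with probability at most `1 / (2 n^ℓ)`.
-/

section Exponential

theorem hasDerivAt_quadratic_mul_exp_neg (t : ℝ) :
    HasDerivAt (fun t : ℝ => (6 + 4 * t + t ^ 2) * Real.exp (-t) + 2 * t)
      (2 - (2 + 2 * t + t ^ 2) * Real.exp (-t)) t := by
  have hpoly : HasDerivAt (fun t : ℝ => 6 + 4 * t + t ^ 2) (4 + 2 * t) t :=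
    ((((hasDerivAt_id t).const_mul 4).const_add 6).add (hasDerivAt_pow 2 t)).congr_deriv
      (by norm_num)
  have hexp : HasDerivAt (fun t : ℝ => Real.exp (-t)) (-Real.exp (-t)) t := by
    simpa using (hasDerivAt_neg t).exp
  exact ((hpoly.mul hexp).add ((hasDerivAt_id t).const_mul 2)).congr_deriv (by ring)

theorem monotoneOn_quadratic_mul_exp_neg :
    MonotoneOn (fun t : ℝ => (6 + 4 * t + t ^ 2) * Real.exp (-t) + 2 * t) (Set.Ici 0) := by
  refine monotoneOn_of_hasDerivWithinAt_nonneg (convex_Ici 0)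
    (fun t _ => (hasDerivAt_quadratic_mul_exp_neg t).continuousAt.continuousWithinAt)
    (fun t _ => (hasDerivAt_quadratic_mul_exp_neg t).hasDerivWithinAt) fun t ht => ?_
  rw [interior_Ici, Set.mem_Ioi] at ht
  rw [sub_nonneg, Real.exp_neg, ← div_eq_mul_inv, div_le_iff₀ (Real.exp_pos t)]
  linarith [Real.quadratic_le_exp_of_nonneg ht.le]

theorem exp_sub_one_sub_le {t : ℝ} (h0 : 0 ≤ t) (h3 : t < 3) :
    Real.exp t - 1 - t ≤ t ^ 2 / (2 * (1 - t / 3)) := by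
  have hmono := monotoneOn_quadratic_mul_exp_neg (Set.mem_Ici.2 le_rfl) (Set.mem_Ici.2 h0) h0
  have hmul : (6 - 2 * t) * Real.exp t ≤ 6 + 4 * t + t ^ 2 := by
    rw [← le_div_iff₀ (Real.exp_pos t), div_eq_mul_inv, ← Real.exp_neg]
    simp only [zero_pow two_ne_zero, mul_zero, neg_zero, Real.exp_zero, mul_one, add_zero] at hmono
    linarith
  rw [le_div_iff₀ (by linarith)]
  nlinarith

theorem exp_neg_le_quadratic {t : ℝ} (h0 : 0 ≤ t) : Real.exp (-t) ≤ 1 - t + t ^ 2 / 2 := by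
  have hexp := Real.quadratic_le_exp_of_nonneg h0
  have hpos : 0 ≤ 1 - t + t ^ 2 / 2 := by nlinarith [sq_nonneg (t - 1)]
  rw [Real.exp_neg, inv_le_iff_one_le_mul₀ (Real.exp_pos t)]
  nlinarith [mul_le_mul_of_nonneg_left hexp hpos, sq_nonneg (t ^ 2)]

theorem exp_mul_le_of_mem_Icc {x : ℝ} (hx : x ∈ Set.Icc (0 : ℝ) 1) (t : ℝ) :
    Real.exp (x * t) ≤ 1 + x * (Real.exp t - 1) := by
  have hconv := convexOn_exp.2 (Set.mem_univ 0) (Set.mem_univ t) (sub_nonneg.2 hx.2) hx.1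
    (sub_add_cancel 1 x)
  simp only [smul_eq_mul, mul_zero, zero_add, Real.exp_zero, mul_one] at hconv
  linarith

theorem one_sub_exp_neg_one_mul_min_le {t : ℝ} (ht : 0 ≤ t) :
    (1 - Real.exp (-1)) * min 1 t ≤ 1 - Real.exp (-t) := by
  rcases le_total t 1 with h | h
  · rw [min_eq_right h]
    have hchord := exp_mul_le_of_mem_Icc ⟨ht, h⟩ (-1)
    rw [mul_neg_one] at hchord
    linarith
  · rw [min_eq_left h, mul_one]
    have : Real.exp (-t) ≤ Real.exp (-1) := Real.exp_le_exp.2 (by linarith)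
    linarith

theorem exp_neg_le_one_div {t K : ℝ} (hK : 0 < K) (h : Real.log K ≤ t) :
    Real.exp (-t) ≤ 1 / K := by
  rw [one_div, ← Real.exp_log (inv_pos.2 hK), Real.log_inv]
  exact Real.exp_le_exp.2 (neg_le_neg h)

end Exponential

section Concentration

variable {Ω ι : Type*} [MeasurableSpace Ω] {μ : Measure Ω} [IsProbabilityMeasure μ]

theorem mgf_le_exp_of_mem_Icc {X : Ω → ℝ} (hX : AEMeasurable X μ)
    (hX01 : ∀ᵐ ω ∂μ, X ω ∈ Set.Icc (0 : ℝ) 1) (t : ℝ) :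
    mgf X μ t ≤ Real.exp (μ[X] * (Real.exp t - 1)) := by
  have hint : Integrable (fun ω => X ω * (Real.exp t - 1)) μ :=
    (Integrable.of_mem_Icc 0 1 hX hX01).mul_const _
  calc mgf X μ t ≤ ∫ ω, (1 + X ω * (Real.exp t - 1)) ∂μ := by
        refine integral_mono_ae (integrable_exp_mul_of_mem_Icc hX hX01)
          ((integrable_const 1).add hint) ?_
        filter_upwards [hX01] with ω hω
        rw [mul_comm t]
        exact exp_mul_le_of_mem_Icc hω t
    _ = μ[X] * (Real.exp t - 1) + 1 := by
        rw [integral_add (integrable_const 1) hint, integral_mul_const, integral_const,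
          probReal_univ, one_smul, add_comm]
    _ ≤ Real.exp (μ[X] * (Real.exp t - 1)) := Real.add_one_le_exp _

variable {X : ι → Ω → ℝ} {s : Finset ι}

theorem mgf_sum_le_exp_of_mem_Icc (hind : iIndepFun X μ) (hX : ∀ i, AEMeasurable (X i) μ)
    (hX01 : ∀ i, ∀ᵐ ω ∂μ, X i ω ∈ Set.Icc (0 : ℝ) 1) (t : ℝ) :
    mgf (∑ i ∈ s, X i) μ t ≤ Real.exp ((∑ i ∈ s, μ[X i]) * (Real.exp t - 1)) := by
  rw [hind.mgf_sum₀ hX, Finset.sum_mul, Real.exp_sum]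
  exact Finset.prod_le_prod (fun _ _ => mgf_nonneg)
    fun i _ => mgf_le_exp_of_mem_Icc (hX i) (hX01 i) t

theorem integrable_exp_mul_sum_of_mem_Icc (hX : ∀ i, AEMeasurable (X i) μ)
    (hX01 : ∀ i, ∀ᵐ ω ∂μ, X i ω ∈ Set.Icc (0 : ℝ) 1) (t : ℝ) :
    Integrable (fun ω => Real.exp (t * (∑ i ∈ s, X i) ω)) μ := by
  refine integrable_exp_mul_of_mem_Icc (a := 0) (b := s.card)
    (s.aemeasurable_sum fun i _ => hX i) ?_
  filter_upwards [(Finset.eventually_all s).2 fun i _ => hX01 i] with ω hω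
  rw [Finset.sum_apply]
  refine ⟨Finset.sum_nonneg fun i hi => (hω i hi).1, ?_⟩
  simpa using Finset.sum_le_sum fun i hi => (hω i hi).2

variable {M a : ℝ}

-- Bernstein's inequality, by the choice `t = a / (M + a / 3)` in the Chernoff bound.
theorem measureReal_sum_ge_le_exp (hind : iIndepFun X μ) (hX : ∀ i, AEMeasurable (X i) μ)
    (hX01 : ∀ i, ∀ᵐ ω ∂μ, X i ω ∈ Set.Icc (0 : ℝ) 1) (hM : ∑ i ∈ s, μ[X i] ≤ M)
    (hM0 : 0 < M) (ha : 0 < a) :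
    μ.real {ω | ∑ i ∈ s, μ[X i] + a ≤ ∑ i ∈ s, X i ω} ≤
      Real.exp (-(a ^ 2 / (2 * M + 2 / 3 * a))) := by
  have hMa : 0 < M + a / 3 := by positivity
  obtain ⟨t, ht⟩ : ∃ t, t = a / (M + a / 3) := ⟨_, rfl⟩
  have ht0 : 0 ≤ t := ht ▸ by positivity
  have ht3 : t < 3 := by rw [ht, div_lt_iff₀ hMa]; linarith
  have hmarkov := measure_ge_le_exp_mul_mgf (∑ i ∈ s, μ[X i] + a) ht0
    (integrable_exp_mul_sum_of_mem_Icc (s := s) hX hX01 t)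
  simp only [Finset.sum_apply] at hmarkov
  calc _ ≤ _ := hmarkov
    _ ≤ Real.exp (-t * (∑ i ∈ s, μ[X i] + a)) *
          Real.exp ((∑ i ∈ s, μ[X i]) * (Real.exp t - 1)) := by
        gcongr
        exact mgf_sum_le_exp_of_mem_Icc hind hX hX01 t
    _ = Real.exp ((∑ i ∈ s, μ[X i]) * (Real.exp t - 1 - t) - t * a) := by
        rw [← Real.exp_add]; ring_nf
    _ ≤ Real.exp (M * (t ^ 2 / (2 * (1 - t / 3))) - t * a) := by
        have h0 : 0 ≤ Real.exp t - 1 - t := by linarith [Real.add_one_le_exp t]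
        gcongr
        exact exp_sub_one_sub_le ht0 ht3
    _ = Real.exp (-(a ^ 2 / (2 * M + 2 / 3 * a))) := by
        have h13 : 1 - t / 3 = M / (M + a / 3) := by rw [ht]; field_simp; ring
        rw [h13, ht]
        congr 1
        field_simp
        ring

theorem measureReal_sum_le_le_exp (hind : iIndepFun X μ) (hX : ∀ i, AEMeasurable (X i) μ)
    (hX01 : ∀ i, ∀ᵐ ω ∂μ, X i ω ∈ Set.Icc (0 : ℝ) 1) (hM : ∑ i ∈ s, μ[X i] ≤ M)
    (hM0 : 0 < M) (ha : 0 < a) :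
    μ.real {ω | ∑ i ∈ s, X i ω ≤ ∑ i ∈ s, μ[X i] - a} ≤ Real.exp (-(a ^ 2 / (2 * M))) := by
  obtain ⟨t, ht⟩ : ∃ t, t = a / M := ⟨_, rfl⟩
  have ht0 : 0 ≤ t := ht ▸ by positivity
  have hmarkov := measure_le_le_exp_mul_mgf (∑ i ∈ s, μ[X i] - a) (neg_nonpos.2 ht0)
    (integrable_exp_mul_sum_of_mem_Icc (s := s) hX hX01 (-t))
  simp only [Finset.sum_apply] at hmarkov
  calc _ ≤ _ := hmarkov
    _ ≤ Real.exp (- -t * (∑ i ∈ s, μ[X i] - a)) *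
          Real.exp ((∑ i ∈ s, μ[X i]) * (Real.exp (-t) - 1)) := by
        gcongr
        exact mgf_sum_le_exp_of_mem_Icc hind hX hX01 (-t)
    _ = Real.exp ((∑ i ∈ s, μ[X i]) * (Real.exp (-t) - 1 + t) - t * a) := by
        rw [← Real.exp_add]; ring_nf
    _ ≤ Real.exp (M * (t ^ 2 / 2) - t * a) := by
        have h0 : 0 ≤ Real.exp (-t) - 1 + t := by linarith [Real.add_one_le_exp (-t)]
        gcongr
        linarith [exp_neg_le_quadratic ht0]
    _ = Real.exp (-(a ^ 2 / (2 * M))) := by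
        rw [ht]
        congr 1
        field_simp
        ring

end Concentration

section Independence

theorem finite_range_of_dependsOn {ι α β : Type*} [Finite α] {f : (ι → α) → β} {s : Set ι}
    (hs : s.Finite) (hf : DependsOn f s) : (Set.range f).Finite := by
  cases isEmpty_or_nonempty β
  · exact Set.toFinite _
  have := hs.to_subtype
  obtain ⟨g, rfl⟩ := dependsOn_iff_exists_comp.1 hf
  exact (Set.finite_range g).subset (Set.range_comp_subset_range _ _)

theorem measurable_of_dependsOn {ι α β : Type*} [Finite α] [MeasurableSpace α]
    [MeasurableSingletonClass α] [MeasurableSpace β] {f : (ι → α) → β} {s : Set ι}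
    (hs : s.Finite) (hf : DependsOn f s) : Measurable f := by
  cases isEmpty_or_nonempty β
  · have := Function.isEmpty f
    exact measurable_of_empty f
  have := hs.to_subtype
  obtain ⟨g, rfl⟩ := dependsOn_iff_exists_comp.1 hf
  exact (measurable_of_finite g).comp (measurable_pi_lambda _ fun i => measurable_pi_apply _)

variable {Ω : Type*} [MeasurableSpace Ω] {μ : Measure Ω} [IsProbabilityMeasure μ]

theorem one_sub_le_measureReal_of_compl_le {s : Set Ω} {c : ℝ} (h : μ.real sᶜ ≤ c) :
    1 - c ≤ μ.real s := by
  have hcover : μ.real Set.univ ≤ μ.real s + μ.real sᶜ := by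
    simpa using measureReal_union_le (μ := μ) s sᶜ
  rw [probReal_univ] at hcover
  linarith

theorem indepFun_of_iIndepFun_sumElim {ι κ α : Type*} [MeasurableSpace α] {X : ι → Ω → α}
    {Y : κ → Ω → α} (hX : ∀ i, Measurable (X i)) (hY : ∀ j, Measurable (Y j))
    (h : iIndepFun (Sum.elim X Y) μ) :
    IndepFun (fun ω i => X i ω) (fun ω j => Y j ω) μ := by
  refine .process_indepFun_process hX hY fun s t => ?_
  have hst : Disjoint (s.map .inl) (t.map .inr : Finset (ι ⊕ κ)) := by
    simp [Finset.disjoint_left]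
  exact (h.indepFun_finset _ _ hst (Sum.rec hX hY)).comp
    (φ := fun a (i : s) => a ⟨.inl i, Finset.mem_map_of_mem _ i.2⟩)
    (ψ := fun a (j : t) => a ⟨.inr j, Finset.mem_map_of_mem _ j.2⟩)
    (measurable_pi_lambda _ fun _ => measurable_pi_apply _)
    (measurable_pi_lambda _ fun _ => measurable_pi_apply _)

theorem measureReal_mem_and_mem_le_of_indepFun {β γ : Type*} [MeasurableSpace β]
    [MeasurableSingletonClass β] [MeasurableSpace γ] {Y : Ω → β} {X : Ω → γ} {S : Set β}
    {B : β → Set γ} {c : ℝ} (h : IndepFun Y X μ) (hY : Measurable Y)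
    (hfin : (Set.range Y).Finite) (hB : ∀ b, MeasurableSet (B b)) (hc : 0 ≤ c)
    (hle : ∀ b ∈ S, μ.real (X ⁻¹' B b) ≤ c) :
    μ.real {ω | Y ω ∈ S ∧ X ω ∈ B (Y ω)} ≤ c := by
  classical
  set T := hfin.toFinset.filter (· ∈ S)
  calc _ ≤ μ.real (⋃ b ∈ T, Y ⁻¹' {b} ∩ X ⁻¹' B b) := by
        refine measureReal_mono (fun ω hω => ?_) (measure_ne_top _ _)
        exact Set.mem_biUnion (x := Y ω) (by simp [T, hω.1]) ⟨rfl, hω.2⟩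
    _ ≤ ∑ b ∈ T, μ.real (Y ⁻¹' {b} ∩ X ⁻¹' B b) := measureReal_biUnion_finset_le _ _
    _ ≤ ∑ b ∈ T, μ.real (Y ⁻¹' {b}) * c := by
        refine Finset.sum_le_sum fun b hb => ?_
        rw [measureReal_def,
          h.measure_inter_preimage_eq_mul _ _ (measurableSet_singleton b) (hB b),
          ENNReal.toReal_mul]
        exact mul_le_mul_of_nonneg_left (hle b (Finset.mem_filter.1 hb).2) measureReal_nonneg
    _ = μ.real (Y ⁻¹' T) * c := by
        rw [← Finset.sum_mul,
          sum_measureReal_preimage_singleton _ fun b _ => hY (measurableSet_singleton b)]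
    _ ≤ c := mul_le_of_le_one_left hc measureReal_le_one

end Independence

section FiniteExpectation

variable {α β : Type*} [Fintype α] [Fintype β] (p : PMF α)

theorem sum_toReal_bind_mul (f : α → PMF β) (φ : β → ℝ) :
    ∑ b, (p.bind f b).toReal * φ b = ∑ a, (p a).toReal * ∑ b, (f a b).toReal * φ b := by
  have hbind : ∀ b, (p.bind f b).toReal = ∑ a, (p a).toReal * (f a b).toReal := fun b => by
    rw [PMF.bind_apply, tsum_fintype, ENNReal.toReal_sum fun a _ =>
      ENNReal.mul_ne_top (p.apply_ne_top a) ((f a).apply_ne_top b)]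
    simp only [ENNReal.toReal_mul]
  simp only [hbind, Finset.sum_mul, Finset.mul_sum, mul_assoc]
  exact Finset.sum_comm

theorem sum_toReal_map_mul (f : α → β) (φ : β → ℝ) :
    ∑ b, (p.map f b).toReal * φ b = ∑ a, (p a).toReal * φ (f a) := by
  classical
  rw [PMF.map, sum_toReal_bind_mul]
  refine Finset.sum_congr rfl fun a _ => ?_
  rw [Finset.sum_eq_single (f a)] <;> simp +contextual [PMF.pure_apply]

end FiniteExpectation

section UnitIntervalProducts

variable {ι : Type*} (s : Finset ι)

theorem prod_sub_prod_le_sum_posPart {a b : ι → ℝ} (ha : ∀ i ∈ s, a i ∈ Set.Icc (0 : ℝ) 1)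
    (hb : ∀ i ∈ s, b i ∈ Set.Icc (0 : ℝ) 1) :
    ∏ i ∈ s, a i - ∏ i ∈ s, b i ≤ ∑ i ∈ s, (a i - b i)⁺ := by
  classical
  induction s using Finset.induction_on with
  | empty => simp
  | insert i s hi ih =>
    simp only [Finset.forall_mem_insert] at ha hb
    rw [Finset.prod_insert hi, Finset.prod_insert hi, Finset.sum_insert hi]
    have hA0 : 0 ≤ ∏ j ∈ s, a j := Finset.prod_nonneg fun j hj => (ha.2 j hj).1
    have hA1 : ∏ j ∈ s, a j ≤ 1 :=
      Finset.prod_le_one (fun j hj => (ha.2 j hj).1) fun j hj => (ha.2 j hj).2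
    calc a i * ∏ j ∈ s, a j - b i * ∏ j ∈ s, b j
        = (a i - b i) * ∏ j ∈ s, a j + b i * (∏ j ∈ s, a j - ∏ j ∈ s, b j) := by ring
      _ ≤ (a i - b i)⁺ * ∏ j ∈ s, a j + b i * ∑ j ∈ s, (a j - b j)⁺ := by
          gcongr
          · exact le_posPart _
          · exact hb.1.1
          · exact ih ha.2 hb.2
      _ ≤ (a i - b i)⁺ + ∑ j ∈ s, (a j - b j)⁺ :=
          add_le_add (mul_le_of_le_one_right (posPart_nonneg _) hA1)
            (mul_le_of_le_one_left (Finset.sum_nonneg fun j _ => posPart_nonneg _) hb.1.2)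

variable {q : ι → ℝ}

theorem one_sub_prod_one_sub_le_sum (hq : ∀ i ∈ s, q i ∈ Set.Icc (0 : ℝ) 1) :
    1 - ∏ i ∈ s, (1 - q i) ≤ ∑ i ∈ s, q i := by
  have h := prod_sub_prod_le_sum_posPart s (a := fun _ => 1) (b := fun i => 1 - q i)
    (fun _ _ => Set.right_mem_Icc.2 zero_le_one)
    fun i hi => Set.Icc.mem_iff_one_sub_mem.1 (hq i hi)
  simp only [Finset.prod_const_one, sub_sub_cancel] at h
  exact h.trans_eq (Finset.sum_congr rfl fun i hi => posPart_of_nonneg (hq i hi).1)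

theorem prod_one_sub_le_exp_neg_sum (hq : ∀ i ∈ s, q i ≤ 1) :
    ∏ i ∈ s, (1 - q i) ≤ Real.exp (-∑ i ∈ s, q i) := by
  rw [← Finset.sum_neg_distrib, Real.exp_sum]
  exact Finset.prod_le_prod (fun i hi => sub_nonneg.2 (hq i hi))
    fun i _ => Real.one_sub_le_exp_neg (q i)

theorem mul_min_one_sum_le_one_sub_prod_one_sub (hq : ∀ i ∈ s, q i ∈ Set.Icc (0 : ℝ) 1) :
    (1 - Real.exp (-1)) * min 1 (∑ i ∈ s, q i) ≤ 1 - ∏ i ∈ s, (1 - q i) :=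
  (one_sub_exp_neg_one_mul_min_le (Finset.sum_nonneg fun i hi => (hq i hi).1)).trans
    (sub_le_sub_left (prod_one_sub_le_exp_neg_sum s fun i hi => (hq i hi).2) 1)

open Classical in
theorem sum_prod_mul_prod_compl_inter {V R : Type*} [Fintype V] [CommRing R] (h : V → R)
    (A : Finset V) :
    ∑ S : Finset V, (∏ u ∈ S, h u) * (∏ v ∈ Sᶜ, (1 - h v)) *
      (if ∃ u ∈ S, u ∈ A then 1 else 0) = 1 - ∏ v ∈ A, (1 - h v) := by
  have htotal : ∑ S : Finset V, (∏ u ∈ S, h u) * ∏ v ∈ Sᶜ, (1 - h v) = 1 := by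
    rw [← Fintype.prod_add]
    simp
  have hmiss : ∑ S : Finset V, (∏ u ∈ S, if u ∈ A then 0 else h u) * ∏ v ∈ Sᶜ, (1 - h v) =
      ∏ v ∈ A, (1 - h v) := by
    rw [← Fintype.prod_add, ← Finset.prod_subset (Finset.subset_univ A)]
    · exact Finset.prod_congr rfl fun v hv => by simp [hv]
    · intro v _ hv
      simp [hv]
  refine Eq.trans ?_ (congrArg₂ (· - ·) htotal hmiss)
  rw [← Finset.sum_sub_distrib]
  refine Finset.sum_congr rfl fun S _ => ?_
  split_ifs with hS
  · obtain ⟨u, hu, huA⟩ := hS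
    rw [Finset.prod_eq_zero hu (f := fun u => if u ∈ A then 0 else h u) (if_pos huA)]
    ring
  · have havoid : (∏ u ∈ S, if u ∈ A then 0 else h u) = ∏ u ∈ S, h u :=
      Finset.prod_congr rfl fun u hu => if_neg fun hA => hS ⟨u, hu, hA⟩
    rw [havoid]
    ring

end UnitIntervalProducts

theorem sub_le_mul_posPart_of_lipschitzOnWith {f : ℝ → ℝ} {s : Set ℝ} {K : ℝ≥0}
    (hf : LipschitzOnWith K f s) (hmono : MonotoneOn f s) {a b : ℝ} (ha : a ∈ s) (hb : b ∈ s) :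
    f b - f a ≤ K * (b - a)⁺ := by
  rcases le_total a b with hab | hba
  · rw [posPart_of_nonneg (sub_nonneg.2 hab)]
    have hdist := hf.dist_le_mul b hb a ha
    rw [Real.dist_eq, Real.dist_eq, abs_of_nonneg (sub_nonneg.2 hab)] at hdist
    exact (le_abs_self _).trans hdist
  · rw [posPart_of_nonpos (sub_nonpos.2 hba), mul_zero]
    exact sub_nonpos.2 (hmono hb ha hba)

section EuclideanCoordinates

variable {d : ℕ} (x y : EuclideanSpace ℝ (Fin d))

theorem sum_abs_sub_le_sqrt_mul_dist : ∑ j, |x j - y j| ≤ √d * dist x y := by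
  rw [EuclideanSpace.dist_eq, ← Real.sqrt_mul d.cast_nonneg]
  refine Real.le_sqrt_of_sq_le ?_
  simpa [Real.dist_eq] using
    sq_sum_le_card_mul_sum_sq (s := Finset.univ) (f := fun j => |x j - y j|)

theorem sum_posPart_add_sum_posPart_le_sqrt_mul_dist :
    ∑ j, (x j - y j)⁺ + ∑ j, (y j - x j)⁺ ≤ √d * dist x y := by
  rw [← Finset.sum_add_distrib]
  refine le_of_eq_of_le (Finset.sum_congr rfl fun j _ => ?_) (sum_abs_sub_le_sqrt_mul_dist x y)
  rw [← neg_sub (x j), posPart_neg, posPart_add_negPart]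

theorem sum_posPart_le_sqrt_mul_dist : ∑ j, (x j - y j)⁺ ≤ √d * dist x y :=
  (le_add_of_nonneg_right (Finset.sum_nonneg fun _ _ => posPart_nonneg _)).trans
    (sum_posPart_add_sum_posPart_le_sqrt_mul_dist x y)

theorem norm_toLp_le_sqrt_mul {f : Fin d → ℝ} {c : ℝ} (hc : 0 ≤ c) (hf : ∀ j, |f j| ≤ c) :
    ‖WithLp.toLp 2 f‖ ≤ √d * c := by
  rw [EuclideanSpace.norm_eq]
  refine Real.sqrt_le_iff.2 ⟨by positivity, ?_⟩
  rw [mul_pow, Real.sq_sqrt d.cast_nonneg, ← nsmul_eq_mul]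
  simpa using Finset.sum_le_card_nsmul Finset.univ _ (c ^ 2) fun j _ =>
    pow_le_pow_left₀ (abs_nonneg _) (hf j) 2

end EuclideanCoordinates

section ProjectedSubgradient

variable {E : Type*} [NormedAddCommGroup E] [InnerProductSpace ℝ E]

theorem dist_le_dist_of_forall_dist_le {K : Set E} (hK : Convex ℝ K) {y z w : E} (hz : z ∈ K)
    (hmin : ∀ v ∈ K, dist y z ≤ dist y v) (hw : w ∈ K) : dist z w ≤ dist y w := by
  have : Nonempty K := ⟨⟨w, hw⟩⟩
  have hinf : ‖y - z‖ = ⨅ v : K, ‖y - v‖ := by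
    refine le_antisymm (le_ciInf fun v => ?_)
      (ciInf_le ⟨0, Set.forall_mem_range.2 fun v => norm_nonneg _⟩ (⟨z, hz⟩ : K))
    simpa only [dist_eq_norm] using hmin v v.2
  have hinner := (norm_eq_iInf_iff_real_inner_le_zero hK hz).1 hinf w hw
  have hexpand := norm_sub_sq_real (y - z) (w - z)
  rw [sub_sub_sub_cancel_right] at hexpand
  rw [dist_comm z, dist_eq_norm, dist_eq_norm]
  refine le_of_sq_le_sq ?_ (norm_nonneg _)
  linarith [sq_nonneg ‖y - z‖]

theorem two_mul_inner_le_of_dist_le_dist_add_smul {x x' y u : E} {η : ℝ} (hη : 0 < η)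
    (h : dist x' y ≤ dist (x + η • u) y) :
    2 * inner ℝ u (y - x) ≤ (dist x y ^ 2 - dist x' y ^ 2) / η + η * ‖u‖ ^ 2 := by
  have hsq : dist x' y ^ 2 ≤ dist x y ^ 2 - η * (2 * inner ℝ u (y - x)) + η * (η * ‖u‖ ^ 2) :=
    calc dist x' y ^ 2 ≤ dist (x + η • u) y ^ 2 := by gcongr
      _ = ‖(x - y) + η • u‖ ^ 2 := by rw [dist_eq_norm, add_sub_right_comm]
      _ = dist x y ^ 2 - η * (2 * inner ℝ u (y - x)) + η * (η * ‖u‖ ^ 2) := by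
        rw [norm_add_sq_real, inner_smul_right, norm_smul, mul_pow, Real.norm_eq_abs, sq_abs,
          real_inner_comm, ← neg_sub y x, inner_neg_right, norm_neg, ← dist_eq_norm, dist_comm]
        ring
  rw [← sub_le_iff_le_add, le_div_iff₀ hη]
  linarith

variable {x u : ℕ → E} {y : E} {Δ L : ℝ}

theorem two_mul_sum_inner_le_of_pos (hΔ : 0 < Δ) (hL : 0 < L) (hdist : ∀ t, dist (x t) y ≤ Δ)
    (hu : ∀ t, ‖u t‖ ≤ L)
    (hstep : ∀ t : ℕ, dist (x (t + 1)) y ≤ dist (x t + (Δ / (L * √((t : ℝ) + 1))) • u t) y)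
    (T : ℕ) :
    2 * ∑ t ∈ Finset.range T, inner ℝ (u t) (y - x t) ≤
      L / Δ * (Δ ^ 2 - dist (x T) y ^ 2) * √T + 2 * Δ * L * √T := by
  induction T with
  | zero => simp
  | succ T ih =>
    rw [Finset.sum_range_succ, mul_add]
    push_cast
    set r := √((T : ℝ) + 1)
    set D := dist (x T) y
    set D' := dist (x (T + 1)) y
    have hr : 0 < r := Real.sqrt_pos.2 (by positivity)
    have hgain : 2 * inner ℝ (u T) (y - x T) ≤ L / Δ * (D ^ 2 - D' ^ 2) * r + Δ * L * (1 / r) :=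
      calc 2 * inner ℝ (u T) (y - x T)
          ≤ (D ^ 2 - D' ^ 2) / (Δ / (L * r)) + Δ / (L * r) * ‖u T‖ ^ 2 :=
            two_mul_inner_le_of_dist_le_dist_add_smul (by positivity) (hstep T)
        _ ≤ (D ^ 2 - D' ^ 2) / (Δ / (L * r)) + Δ / (L * r) * L ^ 2 := by
            gcongr
            exact hu T
        _ = L / Δ * (D ^ 2 - D' ^ 2) * r + Δ * L * (1 / r) := by field_simp
    have hsqrt : √(T : ℝ) ≤ r := Real.sqrt_le_sqrt (by linarith)
    have hinv : 1 / r ≤ 2 * (r - √T) := by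
      rw [div_le_iff₀ hr]
      nlinarith [sq_nonneg (r - √T), Real.sq_sqrt T.cast_nonneg,
        Real.sq_sqrt (show (0 : ℝ) ≤ T + 1 by positivity)]
    have hD : 0 ≤ Δ ^ 2 - D ^ 2 := sub_nonneg.2 (pow_le_pow_left₀ dist_nonneg (hdist T) 2)
    calc _ ≤ L / Δ * (Δ ^ 2 - D ^ 2) * √T + 2 * Δ * L * √T +
          (L / Δ * (D ^ 2 - D' ^ 2) * r + Δ * L * (1 / r)) := add_le_add ih hgain
      _ ≤ L / Δ * (Δ ^ 2 - D ^ 2) * r + 2 * Δ * L * √T +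
          (L / Δ * (D ^ 2 - D' ^ 2) * r + Δ * L * (2 * (r - √T))) := by gcongr
      _ = L / Δ * (Δ ^ 2 - D' ^ 2) * r + 2 * Δ * L * r := by ring

theorem two_mul_sum_inner_le (hdist : ∀ t, dist (x t) y ≤ Δ) (hu : ∀ t, ‖u t‖ ≤ L)
    (hstep : ∀ t : ℕ, dist (x (t + 1)) y ≤ dist (x t + (Δ / (L * √((t : ℝ) + 1))) • u t) y)
    (T : ℕ) :
    2 * ∑ t ∈ Finset.range T, inner ℝ (u t) (y - x t) ≤ 3 * (Δ * L) * √T := by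
  have hΔ : 0 ≤ Δ := dist_nonneg.trans (hdist 0)
  have hL : 0 ≤ L := (norm_nonneg _).trans (hu 0)
  rcases (mul_nonneg hΔ hL).eq_or_lt with hzero | hpos
  · have hinner : ∀ t, inner ℝ (u t) (y - x t) ≤ 0 := fun t =>
      calc inner ℝ (u t) (y - x t) ≤ ‖u t‖ * dist (x t) y := by
            rw [dist_comm, dist_eq_norm]
            exact real_inner_le_norm _ _
        _ ≤ L * Δ := mul_le_mul (hu t) (hdist t) dist_nonneg hL
        _ = 0 := by rw [mul_comm, ← hzero]
    rw [← hzero, mul_zero, zero_mul]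
    linarith [Finset.sum_nonpos fun t (_ : t ∈ Finset.range T) => hinner t]
  · have hΔ' : 0 < Δ := pos_of_mul_pos_left hpos hL
    have hL' : 0 < L := pos_of_mul_pos_right hpos hΔ
    calc _ ≤ L / Δ * (Δ ^ 2 - dist (x T) y ^ 2) * √T + 2 * Δ * L * √T :=
          two_mul_sum_inner_le_of_pos hΔ' hL' hdist hu hstep T
      _ ≤ L / Δ * Δ ^ 2 * √T + 2 * Δ * L * √T := by
          gcongr
          exact sub_le_self _ (sq_nonneg _)
      _ = 3 * (Δ * L) * √T := by
          field_simp
          ring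

end ProjectedSubgradient

namespace TriggeringModel

variable {V : Type*} [Fintype V]

theorem mem_finalActive_iff {T : V → Finset V} {S : Finset V} {v : V} :
    v ∈ finalActive T S ↔ ∃ u ∈ S, u ∈ reverseReachable T v := by
  classical
  simp only [finalActive, reverseReachable, Finset.mem_filter, Finset.mem_univ, true_and]
  constructor
  · rintro ⟨t, ht⟩
    induction t generalizing v with
    | zero => exact ⟨v, ht, .refl⟩
    | succ t ih =>
      simp only [activeAt, Finset.mem_union, Finset.mem_filter, Finset.mem_univ, true_and] at ht
      rcases ht with ht | ⟨u, hu, hut⟩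
      · exact ih ht
      · obtain ⟨w, hw, hwu⟩ := ih hut
        exact ⟨w, hw, hwu.tail hu⟩
  · rintro ⟨u, hu, huv⟩
    induction huv with
    | refl => exact ⟨0, hu⟩
    | tail _ hbc ih =>
      obtain ⟨t, ht⟩ := ih
      refine ⟨t + 1, ?_⟩
      simp only [activeAt, Finset.mem_union, Finset.mem_filter, Finset.mem_univ, true_and]
      exact Or.inr ⟨_, hbc, ht⟩

open Classical in
theorem card_finalActive (T : V → Finset V) (S : Finset V) :
    ((finalActive T S).card : ℝ) =
      ∑ v, if ∃ u ∈ S, u ∈ reverseReachable T v then (1 : ℝ) else 0 := by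
  rw [Finset.sum_boole]
  congr 2
  ext v
  rw [mem_finalActive_iff, Finset.mem_filter, and_iff_right (Finset.mem_univ v)]

open Classical in
theorem sum_rrLaw_mul [Nonempty V] (M : TriggeringModel V) (φ : Finset V → ℝ) :
    ∑ A, (M.rrLaw A).toReal * φ A =
      (Fintype.card V : ℝ)⁻¹ *
        ∑ v, ∑ T, (M.triggerLaw T).toReal * φ (reverseReachable T v) := by
  rw [rrLaw, sum_toReal_bind_mul, Finset.mul_sum]
  refine Finset.sum_congr rfl fun v _ => ?_
  rw [sum_toReal_map_mul, PMF.uniformOfFintype_apply, ENNReal.toReal_inv, ENNReal.toReal_natCast]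

theorem sum_rrLaw [Nonempty V] (M : TriggeringModel V) : ∑ A, (M.rrLaw A).toReal = 1 := by
  rw [← ENNReal.toReal_sum fun A _ => M.rrLaw.apply_ne_top A,
    ← tsum_fintype (L := .unconditional _), M.rrLaw.tsum_coe, ENNReal.toReal_one]

end TriggeringModel

namespace CIMBS

section HitProbability

variable {V : Type*} {d : ℕ}

/-- The probability that a strategy mix seeds some node of `A`: the summand of `ĝ_R` for the RR
set `A`. -/
noncomputable def hitProb (I : CIMBS V d) (A : Finset V) (x : EuclideanSpace ℝ (Fin d)) : ℝ :=
  1 - ∏ v ∈ A, (1 - I.h v x)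

theorem hitProb_eq_one_sub_prod_product (I : CIMBS V d) (A : Finset V)
    (x : EuclideanSpace ℝ (Fin d)) :
    I.hitProb A x = 1 - ∏ i ∈ A ×ˢ Finset.univ, (1 - I.q i.1 i.2 (x i.2)) := by
  simp only [hitProb, h, sub_sub_cancel, Finset.prod_product]

variable {I : CIMBS V d} {x y : EuclideanSpace ℝ (Fin d)}

theorem hitProb_mem_Icc (hx : ∀ j, 0 ≤ x j) (A : Finset V) :
    I.hitProb A x ∈ Set.Icc (0 : ℝ) 1 := by
  have hq : ∀ i : V × Fin d, 1 - I.q i.1 i.2 (x i.2) ∈ Set.Icc (0 : ℝ) 1 := fun i =>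
    Set.Icc.mem_iff_one_sub_mem.1 (I.q_mem i.1 i.2 _ (hx i.2))
  rw [hitProb_eq_one_sub_prod_product]
  exact Set.Icc.mem_iff_one_sub_mem.1
    ⟨Finset.prod_nonneg fun i _ => (hq i).1,
      Finset.prod_le_one (fun i _ => (hq i).1) fun i _ => (hq i).2⟩

theorem hitProb_le_min_one_sum (hx : ∀ j, 0 ≤ x j) (A : Finset V) :
    I.hitProb A x ≤ min 1 (∑ v ∈ A, ∑ j, I.q v j (x j)) := by
  refine le_min (hitProb_mem_Icc hx A).2 ?_
  rw [hitProb_eq_one_sub_prod_product, ← Finset.sum_product']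
  exact one_sub_prod_one_sub_le_sum _ fun i _ => I.q_mem i.1 i.2 _ (hx i.2)

theorem ratio_mul_min_one_sum_le_hitProb (hx : ∀ j, 0 ≤ x j) (A : Finset V) :
    ratio * min 1 (∑ v ∈ A, ∑ j, I.q v j (x j)) ≤ I.hitProb A x := by
  rw [hitProb_eq_one_sub_prod_product, ← Finset.sum_product', ratio, one_div, ← Real.exp_neg]
  exact mul_min_one_sum_le_one_sub_prod_one_sub _ fun i _ => I.q_mem i.1 i.2 _ (hx i.2)

theorem hitProb_sub_le {K : ℝ≥0} (hK : ∀ v j, LipschitzOnWith K (I.q v j) (Set.Ici 0))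
    (hx : ∀ j, 0 ≤ x j) (hy : ∀ j, 0 ≤ y j) (A : Finset V) :
    I.hitProb A x - I.hitProb A y ≤ A.card * (K * ∑ j, (x j - y j)⁺) := by
  rw [hitProb_eq_one_sub_prod_product, hitProb_eq_one_sub_prod_product, sub_sub_sub_cancel_left]
  calc _ ≤ ∑ i ∈ A ×ˢ Finset.univ,
          ((1 - I.q i.1 i.2 (y i.2)) - (1 - I.q i.1 i.2 (x i.2)))⁺ :=
        prod_sub_prod_le_sum_posPart _
          (fun i _ => Set.Icc.mem_iff_one_sub_mem.1 (I.q_mem i.1 i.2 _ (hy i.2)))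
          fun i _ => Set.Icc.mem_iff_one_sub_mem.1 (I.q_mem i.1 i.2 _ (hx i.2))
    _ ≤ ∑ i ∈ A ×ˢ Finset.univ, K * (x i.2 - y i.2)⁺ := by
        refine Finset.sum_le_sum fun i _ => sup_le ?_ (mul_nonneg K.2 (posPart_nonneg _))
        rw [sub_sub_sub_cancel_left]
        exact sub_le_mul_posPart_of_lipschitzOnWith (hK i.1 i.2) (I.q_mono i.1 i.2) (hy i.2)
          (hx i.2)
    _ = A.card * (K * ∑ j, (x j - y j)⁺) := by
        simp only [Finset.sum_product, Finset.sum_const, nsmul_eq_mul, Finset.mul_sum]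

theorem hitProb_sub_le_card_mul [Fintype V] {K : ℝ≥0}
    (hK : ∀ v j, LipschitzOnWith K (I.q v j) (Set.Ici 0)) (hx : ∀ j, 0 ≤ x j)
    (hy : ∀ j, 0 ≤ y j) (A : Finset V) :
    I.hitProb A x - I.hitProb A y ≤ Fintype.card V * (K * ∑ j, (x j - y j)⁺) := by
  refine (hitProb_sub_le hK hx hy A).trans ?_
  gcongr
  exact A.card_le_univ

end HitProbability

section Objective

variable {V : Type*} [Fintype V] {d : ℕ}

theorem gHat_eq_sum_hitProb (I : CIMBS V d) (R : ℕ → Finset V) (θ : ℕ)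
    (x : EuclideanSpace ℝ (Fin d)) :
    I.gHat R θ x = (Fintype.card V : ℝ) / θ * ∑ i ∈ Finset.range θ, I.hitProb (R i) x := rfl

theorem g_eq_sum_rrLaw_mul_hitProb [Nonempty V] (I : CIMBS V d)
    (x : EuclideanSpace ℝ (Fin d)) :
    I.g x = (Fintype.card V : ℝ) * ∑ A, (I.model.rrLaw A).toReal * I.hitProb A x := by
  classical
  rw [TriggeringModel.sum_rrLaw_mul,
    mul_inv_cancel_left₀ (Nat.cast_ne_zero.2 Fintype.card_ne_zero)]
  simp only [g, TriggeringModel.spread, hitProb, TriggeringModel.card_finalActive,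
    ← sum_prod_mul_prod_compl_inter, Finset.mul_sum, Finset.sum_mul]
  rw [Finset.sum_comm]
  conv_rhs => rw [Finset.sum_comm]
  refine Finset.sum_congr rfl fun T _ => ?_
  rw [Finset.sum_comm]
  exact Finset.sum_congr rfl fun v _ => Finset.sum_congr rfl fun S _ => by ring

variable {I : CIMBS V d} {R : ℕ → Finset V} {θ : ℕ} {x y : EuclideanSpace ℝ (Fin d)}

theorem gHat_le_gBar (hx : ∀ j, 0 ≤ x j) : I.gHat R θ x ≤ I.gBar R θ x := by
  rw [gHat_eq_sum_hitProb, gBar]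
  gcongr
  exact hitProb_le_min_one_sum hx _

theorem ratio_mul_gBar_le_gHat (hx : ∀ j, 0 ≤ x j) : ratio * I.gBar R θ x ≤ I.gHat R θ x := by
  rw [gHat_eq_sum_hitProb, gBar, mul_left_comm, Finset.mul_sum]
  gcongr
  exact ratio_mul_min_one_sum_le_hitProb hx _

theorem g_nonneg [Nonempty V] (hx : ∀ j, 0 ≤ x j) : 0 ≤ I.g x := by
  rw [g_eq_sum_rrLaw_mul_hitProb]
  exact mul_nonneg (Nat.cast_nonneg _) (Finset.sum_nonneg fun A _ =>
    mul_nonneg ENNReal.toReal_nonneg (hitProb_mem_Icc hx A).1)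

variable {K : ℝ≥0} (hK : ∀ v j, LipschitzOnWith K (I.q v j) (Set.Ici 0))

include hK

theorem gHat_sub_le (hx : ∀ j, 0 ≤ x j) (hy : ∀ j, 0 ≤ y j) :
    I.gHat R θ x - I.gHat R θ y ≤
      (Fintype.card V : ℝ) ^ 2 * K * ∑ j, (x j - y j)⁺ := by
  rw [gHat_eq_sum_hitProb, gHat_eq_sum_hitProb, ← mul_sub, ← Finset.sum_sub_distrib]
  calc _ ≤ (Fintype.card V : ℝ) / θ *
          ∑ _i ∈ Finset.range θ, (Fintype.card V : ℝ) * (K * ∑ j, (x j - y j)⁺) := by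
        gcongr with i _
        exact hitProb_sub_le_card_mul hK hx hy (R i)
    _ = (θ : ℝ) / θ * ((Fintype.card V : ℝ) ^ 2 * K * ∑ j, (x j - y j)⁺) := by
        rw [Finset.sum_const, Finset.card_range, nsmul_eq_mul]
        ring
    _ ≤ (Fintype.card V : ℝ) ^ 2 * K * ∑ j, (x j - y j)⁺ :=
        mul_le_of_le_one_left (by positivity) (div_self_le_one _)

theorem g_sub_le [Nonempty V] (hx : ∀ j, 0 ≤ x j) (hy : ∀ j, 0 ≤ y j) :
    I.g x - I.g y ≤ (Fintype.card V : ℝ) ^ 2 * K * ∑ j, (x j - y j)⁺ := by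
  rw [g_eq_sum_rrLaw_mul_hitProb, g_eq_sum_rrLaw_mul_hitProb, ← mul_sub,
    ← Finset.sum_sub_distrib]
  simp only [← mul_sub]
  calc _ ≤ (Fintype.card V : ℝ) * ∑ A, (I.model.rrLaw A).toReal *
          ((Fintype.card V : ℝ) * (K * ∑ j, (x j - y j)⁺)) := by
        gcongr with A _
        exact hitProb_sub_le_card_mul hK hx hy A
    _ = (Fintype.card V : ℝ) ^ 2 * K * ∑ j, (x j - y j)⁺ := by
        rw [← Finset.sum_mul, TriggeringModel.sum_rrLaw]
        ring

end Objective

section Projection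

variable {d : ℕ} {P : Set (EuclideanSpace ℝ (Fin d))}

theorem proj_spec (hP : IsClosed P) (hne : P.Nonempty) (y : EuclideanSpace ℝ (Fin d)) :
    proj P y ∈ P ∧ ∀ w ∈ P, dist y (proj P y) ≤ dist y w := by
  refine Classical.epsilon_spec (p := fun z => z ∈ P ∧ ∀ w ∈ P, dist y z ≤ dist y w) ?_
  obtain ⟨z, hz, hyz⟩ := hP.exists_infDist_eq_dist hne y
  exact ⟨z, hz, fun w hw => hyz ▸ Metric.infDist_le_dist_of_mem hw⟩

theorem dist_proj_le (hP : IsClosed P) (hc : Convex ℝ P) {w : EuclideanSpace ℝ (Fin d)}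
    (hw : w ∈ P) (y : EuclideanSpace ℝ (Fin d)) : dist (proj P y) w ≤ dist y w :=
  dist_le_dist_of_forall_dist_le hc (proj_spec hP ⟨w, hw⟩ y).1 (proj_spec hP ⟨w, hw⟩ y).2 hw

-- The projection onto `P` is nonexpansive, so it maps an external cover of `P` to an internal one.
theorem coveringNumber_le_externalCoveringNumber (hP : IsClosed P) (hc : Convex ℝ P)
    (hne : P.Nonempty) (r : ℝ≥0) :
    Metric.coveringNumber r P ≤ Metric.externalCoveringNumber r P := by
  refine le_iInf₂ fun C hC => ?_
  have hcover : Metric.IsCover r P (proj P '' C) := by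
    rw [Metric.isCover_iff_subset_iUnion_closedBall] at hC ⊢
    intro x hx
    obtain ⟨y, hy, hxy⟩ := Set.mem_iUnion₂.1 (hC hx)
    rw [Metric.mem_closedBall, dist_comm] at hxy
    refine Set.mem_iUnion₂.2 ⟨proj P y, Set.mem_image_of_mem _ hy, ?_⟩
    rw [Metric.mem_closedBall, dist_comm]
    exact (dist_proj_le hP hc hx y).trans hxy
  exact (hcover.coveringNumber_le_encard
    (Set.image_subset_iff.2 fun y _ => (proj_spec hP hne y).1)).trans (Set.encard_image_le _ _)

end Projection

section Feasible

variable {V : Type*} {d : ℕ} {I : CIMBS V d} {p : Input V d} {x y : EuclideanSpace ℝ (Fin d)}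

theorem convex_feasible (I : CIMBS V d) : Convex ℝ I.feasible :=
  I.cost_convex.convex_le I.budget

theorem nonneg_of_mem_feasible (hx : x ∈ I.feasible) (j : Fin d) : 0 ≤ x j :=
  I.domain_nonneg x hx.1 j

theorem s_nonneg (hx : x ∈ I.feasible) : 0 ≤ I.s x :=
  mul_nonneg I.lam_nonneg (sub_nonneg.2 hx.2)

theorem s_sub_le {K : ℝ≥0} (hK : LipschitzOnWith K I.cost I.domain) (hx : x ∈ I.domain)
    (hy : y ∈ I.domain) : I.s x - I.s y ≤ I.lam * K * dist x y := by
  have hcost : I.cost y - I.cost x ≤ K * dist x y := by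
    rw [dist_comm]
    exact (le_abs_self _).trans (hK.dist_le_mul y hy x hx)
  calc I.s x - I.s y = I.lam * (I.cost y - I.cost x) := by
        simp only [s]
        ring
    _ ≤ I.lam * (K * dist x y) := mul_le_mul_of_nonneg_left hcost I.lam_nonneg
    _ = I.lam * K * dist x y := (mul_assoc _ _ _).symm

theorem isCompact_feasible (hclosed : IsClosed I.feasible) (hp : p.Valid I) :
    IsCompact I.feasible :=
  Metric.isCompact_of_isClosed_isBounded hclosed
    (Metric.isBounded_iff.2 ⟨p.Δ, fun x hx y hy => hp.dist_le x hx y hy⟩)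

theorem exists_net (hclosed : IsClosed I.feasible) (hp : p.Valid I) {r : ℝ} (hr : 0 < r) :
    ∃ C : Finset (EuclideanSpace ℝ (Fin d)), (∀ z ∈ C, z ∈ I.feasible) ∧
      (C.card : ℝ) ≤ I.covering r ∧ ∀ x ∈ I.feasible, ∃ z ∈ C, dist x z ≤ r := by
  obtain ⟨N, -, hN, hcover⟩ := Metric.exists_finite_isCover_of_isCompact
    (Real.toNNReal_pos.2 hr).ne' (isCompact_feasible hclosed hp)
  have hext : Metric.externalCoveringNumber r.toNNReal I.feasible ≠ ⊤ :=
    (hcover.externalCoveringNumber_le_encard.trans_lt (Set.encard_lt_top_iff.2 hN)).ne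
  have hle := coveringNumber_le_externalCoveringNumber hclosed I.convex_feasible
    ⟨_, hp.x₀_mem⟩ r.toNNReal
  have hint : Metric.coveringNumber r.toNNReal I.feasible ≠ ⊤ := ne_top_of_le_ne_top hext hle
  have hfin : (Metric.minimalCover r.toNNReal I.feasible).Finite := Metric.finite_minimalCover
  refine ⟨hfin.toFinset, fun z hz => Metric.minimalCover_subset (hfin.mem_toFinset.1 hz), ?_,
    fun x hx => ?_⟩
  · rw [covering, ← Set.ncard_eq_toFinset_card _ hfin, Set.ncard, Metric.encard_minimalCover hint]
    exact_mod_cast ENat.toNat_le_toNat hle hext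
  · obtain ⟨z, hz, hxz⟩ :=
      Set.mem_iUnion₂.1 ((Metric.isCover_minimalCover hint).subset_iUnion_closedBall hx)
    rw [Metric.mem_closedBall, Real.coe_toNNReal r hr.le] at hxz
    exact ⟨z, hfin.mem_toFinset.2 hz, hxz⟩

theorem one_le_covering (hclosed : IsClosed I.feasible) (hp : p.Valid I) {r : ℝ} (hr : 0 < r) :
    1 ≤ I.covering r := by
  obtain ⟨C, -, hcard, hC⟩ := exists_net hclosed hp hr
  obtain ⟨z, hz, -⟩ := hC _ hp.x₀_mem
  exact le_trans (mod_cast Finset.card_pos.2 ⟨z, hz⟩) hcard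

end Feasible

section Gradient

theorem ratio_pos : 0 < ratio :=
  sub_pos.2 ((div_lt_one (Real.exp_pos 1)).2 (Real.one_lt_exp_iff.2 one_pos))

theorem ratio_le_two_thirds : ratio ≤ 2 / 3 := by
  have hexp := one_div_le_one_div_of_le (Real.exp_pos 1) Real.exp_one_lt_three.le
  rw [ratio]
  linarith

variable {V : Type*} [Fintype V] {d : ℕ} {I : CIMBS V d} {p : Input V d} {R : ℕ → Finset V}
  {θ : ℕ} {x y : EuclideanSpace ℝ (Fin d)}

/-- The supergradient at `x` of the summand `min {1, ∑_{v ∈ A, j} q_{v,j}}` of `ḡ_R` for the RR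
set `A`: the vector `u_A` in the description of the gradient algorithm. -/
noncomputable def minSupergrad (I : CIMBS V d) (p : Input V d) (A : Finset V)
    (x : EuclideanSpace ℝ (Fin d)) : EuclideanSpace ℝ (Fin d) :=
  if 1 ≤ ∑ v ∈ A, ∑ j, I.q v j (x j) then 0 else WithLp.toLp 2 fun j => ∑ v ∈ A, p.dq v j (x j)

theorem subgrad_eq_sum_minSupergrad :
    subgrad I p R θ x =
      ((Fintype.card V : ℝ) / θ) • ∑ i ∈ Finset.range θ, minSupergrad I p (R i) x -
        I.lam • p.dc x := rfl

omit [Fintype V] in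
theorem min_one_sum_le_add_inner_minSupergrad (hp : p.Valid I) (hx : ∀ j, 0 ≤ x j)
    (hy : ∀ j, 0 ≤ y j) (A : Finset V) :
    min 1 (∑ v ∈ A, ∑ j, I.q v j (y j)) ≤
      min 1 (∑ v ∈ A, ∑ j, I.q v j (x j)) + inner ℝ (minSupergrad I p A x) (y - x) := by
  rw [minSupergrad]
  split_ifs with hsat
  · rw [min_eq_left hsat, inner_zero_left, add_zero]
    exact min_le_left _ _
  · have hinner : inner ℝ (WithLp.toLp 2 fun j => ∑ v ∈ A, p.dq v j (x j)) (y - x) =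
        ∑ v ∈ A, ∑ j, p.dq v j (x j) * (y j - x j) := by
      rw [PiLp.inner_apply, Finset.sum_comm]
      exact Finset.sum_congr rfl fun j _ => by simp [Finset.mul_sum, mul_comm]
    rw [min_eq_right (not_le.1 hsat).le, hinner, ← Finset.sum_add_distrib]
    simp only [← Finset.sum_add_distrib]
    exact (min_le_right _ _).trans (Finset.sum_le_sum fun v _ => Finset.sum_le_sum fun j _ =>
      hp.dq_super v j _ (hx j) _ (hy j))

theorem gBar_add_s_le_add_inner_subgrad (hp : p.Valid I) (hx : x ∈ I.feasible)
    (hy : y ∈ I.feasible) :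
    I.gBar R θ y + I.s y ≤ I.gBar R θ x + I.s x + inner ℝ (subgrad I p R θ x) (y - x) := by
  have hs : I.s y ≤ I.s x - I.lam * inner ℝ (p.dc x) (y - x) := by
    have hcost := mul_le_mul_of_nonneg_left (hp.dc_sub x hx.1 y hy.1) I.lam_nonneg
    simp only [s]
    linarith
  have hg : I.gBar R θ y ≤ I.gBar R θ x + (Fintype.card V : ℝ) / θ *
      ∑ i ∈ Finset.range θ, inner ℝ (minSupergrad I p (R i) x) (y - x) := by
    rw [gBar, gBar, ← mul_add, ← Finset.sum_add_distrib]
    gcongr with i _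
    exact min_one_sum_le_add_inner_minSupergrad hp (nonneg_of_mem_feasible hx)
      (nonneg_of_mem_feasible hy) (R i)
  rw [subgrad_eq_sum_minSupergrad, inner_sub_left, real_inner_smul_left, real_inner_smul_left,
    sum_inner]
  linarith

omit [Fintype V] in
theorem norm_minSupergrad_le (hp : p.Valid I) (hx : ∀ j, 0 ≤ x j) (A : Finset V) :
    ‖minSupergrad I p A x‖ ≤ √d * (A.card * p.Lq) := by
  rw [minSupergrad]
  split_ifs
  · rw [norm_zero]
    positivity
  · refine norm_toLp_le_sqrt_mul (by positivity) fun j =>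
      (Finset.abs_sum_le_sum_abs _ _).trans ?_
    rw [← nsmul_eq_mul]
    exact Finset.sum_le_card_nsmul _ _ _ fun v _ => hp.dq_bound v j _ (hx j)

theorem norm_subgrad_le (hp : p.Valid I) (hx : x ∈ I.feasible) :
    ‖subgrad I p R θ x‖ ≤ lipBar I p R θ := by
  rw [subgrad_eq_sum_minSupergrad]
  refine (norm_sub_le _ _).trans (add_le_add ?_ ?_)
  · rw [norm_smul, Real.norm_of_nonneg (by positivity)]
    calc _ ≤ (Fintype.card V : ℝ) / θ * ∑ i ∈ Finset.range θ, √d * ((R i).card * p.Lq) := by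
          gcongr
          exact norm_sum_le_of_le _ fun i _ =>
            norm_minSupergrad_le hp (nonneg_of_mem_feasible hx) (R i)
      _ = avgSize R θ * Fintype.card V * √d * p.Lq := by
          rw [← Finset.mul_sum, ← Finset.sum_mul, avgSize]
          ring
  · rw [norm_smul, Real.norm_of_nonneg I.lam_nonneg]
    exact mul_le_mul_of_nonneg_left (hp.dc_bound x hx.1) I.lam_nonneg

theorem iterate_mem_feasible (hclosed : IsClosed I.feasible) (hx₀ : p.x₀ ∈ I.feasible) (t : ℕ) :
    iterate I p R θ t ∈ I.feasible := by
  cases t with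
  | zero => exact hx₀
  | succ t => exact (proj_spec hclosed ⟨_, hx₀⟩ _).1

theorem best_mem_feasible (hclosed : IsClosed I.feasible) (hx₀ : p.x₀ ∈ I.feasible) (t : ℕ) :
    best I p R θ t ∈ I.feasible := by
  induction t with
  | zero => exact hx₀
  | succ t ih =>
    rw [best]
    split_ifs
    · exact iterate_mem_feasible hclosed hx₀ _
    · exact ih

theorem upperGrad_mem_feasible (hclosed : IsClosed I.feasible) (hx₀ : p.x₀ ∈ I.feasible)
    (R : ℕ → Finset V) (θ : ℕ) (δ : ℝ) : upperGrad I p R θ δ ∈ I.feasible :=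
  best_mem_feasible hclosed hx₀ _

theorem iterate_le_best {t T : ℕ} (h : t ≤ T) :
    I.gBar R θ (iterate I p R θ t) + I.s (iterate I p R θ t) ≤
      I.gBar R θ (best I p R θ T) + I.s (best I p R θ T) := by
  induction T with
  | zero =>
    obtain rfl : t = 0 := Nat.le_zero.1 h
    exact le_rfl
  | succ T ih =>
    rw [best]
    rcases Nat.le_succ_iff.1 h with h | rfl
    · split_ifs with hlt
      · exact (ih h).trans hlt.le
      · exact ih h
    · split_ifs with hlt
      · exact le_rfl
      · exact not_lt.1 hlt

theorem gBar_add_s_sub_le_best (hclosed : IsClosed I.feasible) (hp : p.Valid I)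
    (hy : y ∈ I.feasible) (T : ℕ) :
    2 * (I.gBar R θ y + I.s y - (I.gBar R θ (best I p R θ T) + I.s (best I p R θ T))) *
        √((T : ℝ) + 1) ≤ 3 * (p.Δ * lipBar I p R θ) := by
  set x := iterate I p R θ
  set gap := I.gBar R θ y + I.s y - (I.gBar R θ (best I p R θ T) + I.s (best I p R θ T))
  have hx : ∀ t, x t ∈ I.feasible := iterate_mem_feasible hclosed hp.x₀_mem
  have hgap : ∀ t ∈ Finset.range (T + 1),
      gap ≤ inner ℝ (subgrad I p R θ (x t)) (y - x t) := fun t ht => by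
    have hgrad := gBar_add_s_le_add_inner_subgrad (R := R) (θ := θ) hp (hx t) hy
    have hbest : I.gBar R θ (x t) + I.s (x t) ≤ _ :=
      iterate_le_best (Nat.lt_succ_iff.1 (Finset.mem_range.1 ht))
    linarith
  have hregret := two_mul_sum_inner_le (x := x) (u := fun t => subgrad I p R θ (x t))
    (fun t => hp.dist_le _ (hx t) _ hy) (fun t => norm_subgrad_le hp (hx t))
    (fun t => dist_proj_le hclosed I.convex_feasible hy _) (T + 1)
  have hsum := Finset.card_nsmul_le_sum _ _ gap hgap
  rw [Finset.card_range, nsmul_eq_mul] at hsum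
  push_cast at hsum hregret
  have hsqrt : √((T : ℝ) + 1) * √((T : ℝ) + 1) = T + 1 := Real.mul_self_sqrt (by positivity)
  refine le_of_mul_le_mul_right ?_ (Real.sqrt_pos.2 (by positivity : (0 : ℝ) < T + 1))
  rw [mul_assoc _ √_, hsqrt]
  linarith

theorem gBar_add_s_le_upperGrad (hclosed : IsClosed I.feasible) (hp : p.Valid I) {δ : ℝ}
    (hδ : 0 < δ) (hy : y ∈ I.feasible) :
    I.gBar R θ y + I.s y ≤
      I.gBar R θ (upperGrad I p R θ δ) + I.s (upperGrad I p R θ δ) + δ / 2 := by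
  rw [upperGrad]
  set T := ⌈9 * (p.Δ * lipBar I p R θ) ^ 2 / δ ^ 2⌉₊
  have hT : 3 * (p.Δ * lipBar I p R θ) / δ ≤ √((T : ℝ) + 1) := by
    refine Real.le_sqrt_of_sq_le ?_
    calc (3 * (p.Δ * lipBar I p R θ) / δ) ^ 2
        = 9 * (p.Δ * lipBar I p R θ) ^ 2 / δ ^ 2 := by ring
      _ ≤ (T : ℝ) := Nat.le_ceil _
      _ ≤ (T : ℝ) + 1 := le_add_of_nonneg_right zero_le_one
  rw [div_le_iff₀' hδ] at hT
  have hgap := le_of_mul_le_mul_right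
    ((gBar_add_s_sub_le_best (R := R) (θ := θ) hclosed hp hy T).trans hT)
    (Real.sqrt_pos.2 (by positivity))
  linarith

theorem ratio_mul_le_upperGrad (hclosed : IsClosed I.feasible) (hp : p.Valid I) {δ : ℝ}
    (hδ : 0 < δ) (hy : y ∈ I.feasible) :
    ratio * (I.gHat R θ y + I.s y - δ / 2) ≤
      I.gHat R θ (upperGrad I p R θ δ) + I.s (upperGrad I p R θ δ) := by
  set x := upperGrad I p R θ δ
  have hx : x ∈ I.feasible := upperGrad_mem_feasible hclosed hp.x₀_mem R θ δ
  calc ratio * (I.gHat R θ y + I.s y - δ / 2) ≤ ratio * (I.gBar R θ x + I.s x) := by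
        refine mul_le_mul_of_nonneg_left ?_ ratio_pos.le
        have hbar := gBar_add_s_le_upperGrad (R := R) (θ := θ) hclosed hp hδ hy
        have hhat : I.gHat R θ y ≤ I.gBar R θ y := gHat_le_gBar (nonneg_of_mem_feasible hy)
        linarith
    _ = ratio * I.gBar R θ x + ratio * I.s x := mul_add _ _ _
    _ ≤ I.gHat R θ x + I.s x :=
        add_le_add (ratio_mul_gBar_le_gHat (nonneg_of_mem_feasible hx))
          (mul_le_of_le_one_left (s_nonneg hx) (ratio_le_two_thirds.trans (by norm_num)))

end Gradient

section Lipschitz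

variable {V : Type*} [Fintype V] {d : ℕ} {I : CIMBS V d} {p : Input V d} {R : ℕ → Finset V}
  {θ : ℕ} {x y : EuclideanSpace ℝ (Fin d)}

theorem lip_nonneg (I : CIMBS V d) (p : Input V d) : 0 ≤ lip I p :=
  add_nonneg (by positivity) (mul_nonneg I.lam_nonneg p.Lc.2)

theorem add_s_sub_le_lip_mul_dist (hp : p.Valid I) (hx : x ∈ I.feasible) (hy : y ∈ I.feasible)
    {f : EuclideanSpace ℝ (Fin d) → ℝ}
    (hf : f x - f y ≤ (Fintype.card V : ℝ) ^ 2 * p.Lq * ∑ j, (x j - y j)⁺) :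
    f x + I.s x - (f y + I.s y) ≤ lip I p * dist x y :=
  calc f x + I.s x - (f y + I.s y) = f x - f y + (I.s x - I.s y) := by ring
    _ ≤ (Fintype.card V : ℝ) ^ 2 * p.Lq * (√d * dist x y) + I.lam * p.Lc * dist x y := by
        refine add_le_add (hf.trans ?_) (s_sub_le hp.cost_lipschitz hx.1 hy.1)
        gcongr
        exact sum_posPart_le_sqrt_mul_dist x y
    _ = lip I p * dist x y := by
        rw [lip]
        ring

theorem gHat_add_s_sub_le (hp : p.Valid I) (hx : x ∈ I.feasible) (hy : y ∈ I.feasible) :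
    I.gHat R θ x + I.s x - (I.gHat R θ y + I.s y) ≤ lip I p * dist x y :=
  add_s_sub_le_lip_mul_dist hp hx hy
    (gHat_sub_le hp.q_lipschitz (nonneg_of_mem_feasible hx) (nonneg_of_mem_feasible hy))

theorem g_add_s_sub_le [Nonempty V] (hp : p.Valid I) (hx : x ∈ I.feasible)
    (hy : y ∈ I.feasible) : I.g x + I.s x - (I.g y + I.s y) ≤ lip I p * dist x y :=
  add_s_sub_le_lip_mul_dist hp hx hy
    (g_sub_le hp.q_lipschitz (nonneg_of_mem_feasible hx) (nonneg_of_mem_feasible hy))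

-- The error `ĝ_R - g` does not need twice the Lipschitz constant, because `ĝ_R` and `g` are both
-- nondecreasing: one increases only with the positive, the other only with the negative parts of
-- the coordinates of `x - y`.
theorem gHat_sub_g_sub_le [Nonempty V] (hp : p.Valid I) (hx : x ∈ I.feasible)
    (hy : y ∈ I.feasible) :
    I.gHat R θ x - I.g x - (I.gHat R θ y - I.g y) ≤ lip I p * dist x y := by
  have hx' := nonneg_of_mem_feasible hx
  have hy' := nonneg_of_mem_feasible hy
  calc I.gHat R θ x - I.g x - (I.gHat R θ y - I.g y)
      = I.gHat R θ x - I.gHat R θ y + (I.g y - I.g x) := by ring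
    _ ≤ (Fintype.card V : ℝ) ^ 2 * p.Lq * ∑ j, (x j - y j)⁺ +
          (Fintype.card V : ℝ) ^ 2 * p.Lq * ∑ j, (y j - x j)⁺ :=
        add_le_add (gHat_sub_le hp.q_lipschitz hx' hy') (g_sub_le hp.q_lipschitz hy' hx')
    _ ≤ (Fintype.card V : ℝ) ^ 2 * p.Lq * (√d * dist x y) := by
        rw [← mul_add]
        gcongr
        exact sum_posPart_add_sum_posPart_le_sqrt_mul_dist x y
    _ ≤ lip I p * dist x y := by
        rw [lip, add_mul, ← mul_assoc, mul_right_comm _ (p.Lq : ℝ)]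
        exact le_add_of_nonneg_right
          (mul_nonneg (mul_nonneg I.lam_nonneg p.Lc.2) dist_nonneg)

theorem isCompact_image_feasible [Nonempty V] (hclosed : IsClosed I.feasible) (hp : p.Valid I) :
    IsCompact ((fun x => I.g x + I.s x) '' I.feasible) := by
  refine (isCompact_feasible hclosed hp).image_of_continuousOn
    (LipschitzOnWith.of_dist_le_mul (K := ⟨lip I p, lip_nonneg I p⟩)
      fun x hx y hy => ?_).continuousOn
  rw [Real.dist_eq, abs_sub_le_iff]
  exact ⟨g_add_s_sub_le hp hx hy, dist_comm x y ▸ g_add_s_sub_le hp hy hx⟩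

theorem exists_opt_eq [Nonempty V] (hclosed : IsClosed I.feasible) (hp : p.Valid I) :
    ∃ y ∈ I.feasible, I.g y + I.s y = I.opt :=
  (isCompact_image_feasible hclosed hp).sSup_mem ⟨_, p.x₀, hp.x₀_mem, rfl⟩

theorem le_opt [Nonempty V] (hclosed : IsClosed I.feasible) (hp : p.Valid I)
    (hx : x ∈ I.feasible) : I.g x + I.s x ≤ I.opt :=
  le_csSup (isCompact_image_feasible hclosed hp).bddAbove ⟨x, hx, rfl⟩

end Lipschitz

section SamplingPhase

variable {V : Type*} [Fintype V] {d : ℕ} {I : CIMBS V d} {p : Input V d} {R : ℕ → Finset V}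

omit [Fintype V] in
theorem epsPrime_pos (hε : 0 < p.ε) : 0 < epsPrime p := by
  rw [epsPrime]
  positivity

theorem guess_pos [Nonempty V] (I : CIMBS V d) (i : ℕ) : 0 < I.guess i := by
  have hn : (0 : ℝ) < Fintype.card V := Nat.cast_pos.2 Fintype.card_pos
  exact div_pos (add_pos_of_pos_of_nonneg hn (mul_nonneg I.lam_nonneg I.budget_nonneg))
    (by positivity)

theorem samplingLoop_pos [Nonempty V] (hε : 0 < p.ε) (m i : ℕ) : 0 < samplingLoop I p R m i := by
  have hε' := epsPrime_pos hε
  induction m generalizing i with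
  | zero => exact one_pos
  | succ m ih =>
    rw [samplingLoop]
    split_ifs with htest
    · have hguess := guess_pos I i
      exact div_pos (lt_of_lt_of_le (by positivity) htest) (by positivity)
    · exact ih _

theorem exists_round_of_lt_samplingLoop (hε : 0 < p.ε) {a : ℝ} (ha : 1 ≤ a) {m i : ℕ}
    (h : a < samplingLoop I p R m i) :
    ∃ j ∈ Finset.Ico i (i + m),
      (1 + epsPrime p + p.ε / 3) * max (I.guess j) a ≤ roundValue I p R j := by
  have hc : 0 < 1 + epsPrime p + p.ε / 3 := by linarith [epsPrime_pos hε]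
  induction m generalizing i with
  | zero => exact absurd h ha.not_gt
  | succ m ih =>
    rw [samplingLoop] at h
    split_ifs at h with htest
    · rw [lt_div_iff₀' hc] at h
      refine ⟨i, Finset.mem_Ico.2 (by omega), ?_⟩
      rw [mul_max_of_nonneg _ _ hc.le]
      exact max_le htest h.le
    · obtain ⟨j, hj, hround⟩ := ih h
      rw [Finset.mem_Ico] at hj
      exact ⟨j, Finset.mem_Ico.2 (by omega), hround⟩

-- The test of the round compares `ĝ_R + s` at the output of the gradient algorithm, which depends
-- on `R`, so that the tail bounds do not apply to it; they do apply to the points of a fixed net.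
theorem exists_mem_net_of_le_roundValue [Nonempty V] (hclosed : IsClosed I.feasible)
    (hp : p.Valid I) (hlip : 0 < lip I p) {C : Finset (EuclideanSpace ℝ (Fin d))} {i : ℕ}
    (hCI : ∀ z ∈ C, z ∈ I.feasible)
    (hC : ∀ x ∈ I.feasible, ∃ z ∈ C, dist x z ≤ p.ε / 3 / lip I p * I.guess i) {M : ℝ}
    (hguess : I.guess i ≤ M) (hopt : I.opt ≤ M)
    (hround : (1 + epsPrime p + p.ε / 3) * M ≤ roundValue I p R i) :
    ∃ z ∈ C, I.g z + epsPrime p * M ≤ I.gHat R (theta I p i) z := by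
  rw [roundValue] at hround
  set x := upperGrad I p R (theta I p i) (p.ε * I.guess i / 3)
  have hx : x ∈ I.feasible := upperGrad_mem_feasible hclosed hp.x₀_mem ..
  obtain ⟨z, hzC, hxz⟩ := hC x hx
  have hz := hCI z hzC
  have hdist : lip I p * dist x z ≤ p.ε / 3 * M := by
    calc lip I p * dist x z ≤ lip I p * (p.ε / 3 / lip I p * I.guess i) := by gcongr
      _ = p.ε / 3 * I.guess i := by field_simp
      _ ≤ p.ε / 3 * M := mul_le_mul_of_nonneg_left hguess (by linarith [hp.ε_pos])
  have hhat := gHat_add_s_sub_le (R := R) (θ := theta I p i) hp hx hz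
  have hzopt := le_opt hclosed hp hz
  exact ⟨z, hzC, by linarith⟩

theorem log_covering_mul_le_theta_mul [Nonempty V] (hclosed : IsClosed I.feasible)
    (hp : p.Valid I) (hlip : 0 < lip I p)
    (hlog : 0 < Real.logb 2 ((Fintype.card V : ℝ) + I.lam * I.budget)) {i : ℕ} {M : ℝ}
    (hguess : I.guess i ≤ M) :
    Real.log (I.covering (p.ε / 3 / lip I p * I.guess i) * ((Fintype.card V : ℝ) ^ p.ℓ * 2 *
        Real.logb 2 ((Fintype.card V : ℝ) + I.lam * I.budget))) ≤
      theta I p i * ((epsPrime p * M) ^ 2 /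
        ((Fintype.card V : ℝ) * (2 * M + 2 / 3 * (epsPrime p * M)))) := by
  have hn : (0 : ℝ) < Fintype.card V := Nat.cast_pos.2 Fintype.card_pos
  have hε := hp.ε_pos
  have hε' := epsPrime_pos hε
  have hguess0 := guess_pos I i
  have hM : 0 < M := hguess0.trans_le hguess
  have hcov : 0 < I.covering (p.ε / 3 / lip I p * I.guess i) :=
    one_pos.trans_le (one_le_covering hclosed hp (by positivity))
  have hθ := Nat.le_ceil ((Fintype.card V : ℝ) * (2 + 2 / 3 * epsPrime p) *
    (Real.log (I.covering (p.ε / 3 / lip I p * I.guess i)) + p.ℓ * Real.log (Fintype.card V) +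
      Real.log 2 + Real.log (Real.logb 2 ((Fintype.card V : ℝ) + I.lam * I.budget))) /
    (epsPrime p ^ 2 * I.guess i))
  rw [← theta, div_le_iff₀ (by positivity), ← Real.log_rpow hn, add_assoc, add_assoc,
    ← Real.log_mul two_ne_zero hlog.ne', ← Real.log_mul (by positivity) (by positivity),
    ← Real.log_mul (by positivity) (by positivity), ← mul_assoc (_ ^ _)] at hθ
  calc _ ≤ theta I p i * (epsPrime p ^ 2 * I.guess i) /
        ((Fintype.card V : ℝ) * (2 + 2 / 3 * epsPrime p)) := (le_div_iff₀' (by positivity)).2 hθ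
    _ ≤ theta I p i * (epsPrime p ^ 2 * M) /
        ((Fintype.card V : ℝ) * (2 + 2 / 3 * epsPrime p)) := by gcongr
    _ = _ := by field_simp

end SamplingPhase

section FinalPhase

variable {V : Type*} [Fintype V] {d : ℕ} {I : CIMBS V d} {p : Input V d} {R : ℕ → Finset V}
  {θ : ℕ} {b : ℝ}

theorem ratio_sub_mul_opt_le_of_lt_gHat (hclosed : IsClosed I.feasible) (hp : p.Valid I)
    (hb : 0 < b) (hbopt : b ≤ I.opt) {y : EuclideanSpace ℝ (Fin d)} (hy : y ∈ I.feasible)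
    (hyopt : I.g y + I.s y = I.opt)
    (hlow : I.g y - (ratio - p.ε / 3) * p.ε / 6 * I.opt < I.gHat R θ y) :
    (ratio - p.ε / 2) * I.opt ≤
      I.gHat R θ (upperGrad I p R θ (p.ε * b)) + I.s (upperGrad I p R θ (p.ε * b)) := by
  have hε := hp.ε_pos
  have hεopt : 0 ≤ p.ε * I.opt := mul_nonneg hε.le (hb.le.trans hbopt)
  have hratio0 : 0 ≤ ratio := ratio_pos.le
  have hratio := ratio_le_two_thirds
  have hsampling : ratio * (ratio - p.ε / 3) * (p.ε * I.opt) ≤ 2 / 3 * (2 / 3) * (p.ε * I.opt) :=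
    mul_le_mul_of_nonneg_right
      ((mul_le_mul_of_nonneg_left (by linarith : ratio - p.ε / 3 ≤ 2 / 3) hratio0).trans
        (by linarith)) hεopt
  have hgradient : ratio * (p.ε * b) ≤ 2 / 3 * (p.ε * I.opt) := by gcongr
  calc (ratio - p.ε / 2) * I.opt
      ≤ ratio * ((1 - (ratio - p.ε / 3) * p.ε / 6) * I.opt - p.ε * b / 2) := by linarith
    _ ≤ ratio * (I.gHat R θ y + I.s y - p.ε * b / 2) :=
        mul_le_mul_of_nonneg_left (by linarith) hratio0
    _ ≤ _ := ratio_mul_le_upperGrad hclosed hp (by positivity) hy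

theorem exists_mem_net_of_lt [Nonempty V] (hp : p.Valid I) (hlip : 0 < lip I p)
    (hbopt : b ≤ I.opt)
    {C : Finset (EuclideanSpace ℝ (Fin d))} (hCI : ∀ z ∈ C, z ∈ I.feasible)
    (hC : ∀ x ∈ I.feasible, ∃ z ∈ C, dist x z ≤ p.ε / 3 / (lip I p + lip I p) * b)
    {x : EuclideanSpace ℝ (Fin d)} (hx : x ∈ I.feasible)
    (hgHat : (ratio - p.ε / 2) * I.opt ≤ I.gHat R θ x + I.s x)
    (hg : I.g x + I.s x < (ratio - p.ε) * I.opt) :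
    ∃ z ∈ C, I.g z ≤ (ratio - 5 * p.ε / 6) * I.opt ∧
      I.g z + p.ε / 3 * I.opt ≤ I.gHat R θ z := by
  obtain ⟨z, hzC, hxz⟩ := hC x hx
  have hz := hCI z hzC
  have hdist : lip I p * dist x z ≤ p.ε / 6 * I.opt := by
    calc lip I p * dist x z ≤ lip I p * (p.ε / 3 / (lip I p + lip I p) * b) := by gcongr
      _ = p.ε / 6 * b := by
        field_simp
        ring
      _ ≤ p.ε / 6 * I.opt := mul_le_mul_of_nonneg_left hbopt (by linarith [hp.ε_pos])
  have hgz := g_add_s_sub_le hp hz hx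
  have herr := gHat_sub_g_sub_le (R := R) (θ := θ) hp hx hz
  have hsz := s_nonneg hz
  rw [dist_comm] at hgz
  exact ⟨z, hzC, by linarith, by linarith⟩

theorem log_le_thetaFinal_mul [Nonempty V] (hε : 0 < p.ε) (hratio : p.ε < ratio)
    (hb : 0 < b) (hbopt : b ≤ I.opt) :
    Real.log (4 * (Fintype.card V : ℝ) ^ p.ℓ) ≤
      thetaFinal I p b * (((ratio - p.ε / 3) * p.ε / 6 * I.opt) ^ 2 /
        ((Fintype.card V : ℝ) * (2 * I.opt))) := by
  have hratio' : 0 < ratio - p.ε / 3 := by linarith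
  have hopt : 0 < I.opt := hb.trans_le hbopt
  have hθ : theta1 I p b ≤ thetaFinal I p b := (le_max_left _ _).trans (Nat.le_ceil _)
  rw [theta1, div_le_iff₀ (by positivity)] at hθ
  calc _ ≤ thetaFinal I p b * (b * (ratio - p.ε / 3) ^ 2 * p.ε ^ 2 / 9) /
        (8 * (Fintype.card V : ℝ)) := (le_div_iff₀' (by positivity)).2 hθ
    _ ≤ thetaFinal I p b * (I.opt * (ratio - p.ε / 3) ^ 2 * p.ε ^ 2 / 9) /
        (8 * (Fintype.card V : ℝ)) := by gcongr
    _ = _ := by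
      field_simp
      ring

theorem log_covering_mul_le_thetaFinal_mul [Nonempty V] (hε : 0 < p.ε) (hratio : p.ε < ratio)
    (hb : 0 < b) (hbopt : b ≤ I.opt) :
    Real.log (I.covering (p.ε / 3 / (lip I p + lip I p) * b) *
        (4 * (Fintype.card V : ℝ) ^ p.ℓ)) ≤
      thetaFinal I p b * ((p.ε / 3 * I.opt) ^ 2 / ((Fintype.card V : ℝ) *
        (2 * ((ratio - 5 * p.ε / 6) * I.opt) + 2 / 3 * (p.ε / 3 * I.opt)))) := by
  have hopt : 0 < I.opt := hb.trans_le hbopt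
  have hθ : theta2 I p b ≤ thetaFinal I p b := (le_max_right _ _).trans (Nat.le_ceil _)
  rw [theta2, mul_comm (4 * _)] at hθ
  have hεopt : 0 < p.ε * I.opt := mul_pos hε hopt
  have hM : 0 < (ratio - 5 * p.ε / 6) * I.opt := mul_pos (by linarith) hopt
  have hden : 2 * ((ratio - 5 * p.ε / 6) * I.opt) + 2 / 3 * (p.ε / 3 * I.opt) ≤
      2 * (ratio - p.ε / 3) * I.opt := by linarith
  obtain ⟨α', hα'⟩ : ∃ α', α' = ratio - p.ε / 3 := ⟨_, rfl⟩
  rw [← hα'] at hθ hden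
  have hα'0 : 0 < α' := by linarith
  have hα'1 : α' ^ 2 ≤ 1 := pow_le_one₀ hα'0.le (by linarith [ratio_le_two_thirds])
  obtain ⟨ε₂, hε₂⟩ : ∃ ε₂, ε₂ = p.ε / 3 - 1 / 4 * α' ^ 2 * (p.ε / 3) := ⟨_, rfl⟩
  rw [← hε₂] at hθ
  have hε₂0 : 0 < ε₂ := by linarith [mul_le_mul_of_nonneg_right hα'1 hε.le]
  have hε₂le : ε₂ ≤ p.ε / 3 := by linarith [mul_nonneg (sq_nonneg α') hε.le]
  rw [div_le_iff₀ (by positivity)] at hθ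
  calc _ ≤ thetaFinal I p b * (ε₂ ^ 2 * b) / (2 * α' * (Fintype.card V : ℝ)) :=
        (le_div_iff₀' (by positivity)).2 hθ
    _ ≤ thetaFinal I p b * ((p.ε / 3) ^ 2 * I.opt) / (2 * α' * (Fintype.card V : ℝ)) := by gcongr
    _ = thetaFinal I p b * ((p.ε / 3 * I.opt) ^ 2 /
          ((Fintype.card V : ℝ) * (2 * α' * I.opt))) := by field_simp
    _ ≤ _ := by gcongr

end FinalPhase

end CIMBS

/-- `R 0, R 1, …` are independent random RR sets on the probability space `(Ω, μ)`. -/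
structure TriggeringModel.IsRRSequence {V Ω : Type*} [Fintype V] [Nonempty V] [MeasurableSpace Ω]
    (M : TriggeringModel V) (μ : Measure Ω) (R : ℕ → Ω → Finset V) : Prop where
  measurable : ∀ i, Measurable (R i)
  map_eq : ∀ i, μ.map (R i) = M.rrLaw.toMeasure
  iIndepFun : iIndepFun R μ

namespace CIMBS

section Estimation

variable {V : Type*} [Fintype V] {d : ℕ} {I : CIMBS V d} {p : Input V d} {Ω : Type*}
  [MeasurableSpace Ω] {μ : Measure Ω} [IsProbabilityMeasure μ] {R : ℕ → Ω → Finset V}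
  {x : EuclideanSpace ℝ (Fin d)} {M a : ℝ}

theorem sum_hitProb_eq [Nonempty V] {R : ℕ → Finset V} {θ : ℕ} (hθ : θ ≠ 0) :
    ∑ i ∈ Finset.range θ, I.hitProb (R i) x = θ * (I.gHat R θ x / Fintype.card V) := by
  rw [gHat_eq_sum_hitProb]
  field_simp

variable [Nonempty V]

omit [IsProbabilityMeasure μ] in
theorem integral_hitProb (hR : I.model.IsRRSequence μ R) (i : ℕ) :
    ∫ ω, I.hitProb (R i ω) x ∂μ = I.g x / Fintype.card V := by
  have hmeas : Measurable fun A : Finset V => I.hitProb A x := .of_discrete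
  rw [← integral_map (hR.measurable i).aemeasurable hmeas.aestronglyMeasurable, hR.map_eq,
    PMF.integral_eq_sum, g_eq_sum_rrLaw_mul_hitProb,
    mul_div_cancel_left₀ _ (Nat.cast_ne_zero.2 Fintype.card_ne_zero)]
  rfl

omit [IsProbabilityMeasure μ] in
theorem sum_integral_hitProb (hR : I.model.IsRRSequence μ R) (θ : ℕ) :
    ∑ i ∈ Finset.range θ, ∫ ω, I.hitProb (R i ω) x ∂μ = θ * (I.g x / Fintype.card V) := by
  simp only [integral_hitProb hR, Finset.sum_const, Finset.card_range, nsmul_eq_mul]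

theorem measureReal_g_add_le_gHat_le_exp (hR : I.model.IsRRSequence μ R) (hx : ∀ j, 0 ≤ x j)
    (hgM : I.g x ≤ M) (hM : 0 < M) (ha : 0 < a) (θ : ℕ) :
    μ.real {ω | I.g x + a ≤ I.gHat (fun i => R i ω) θ x} ≤
      Real.exp (-(θ * (a ^ 2 / ((Fintype.card V : ℝ) * (2 * M + 2 / 3 * a))))) := by
  rcases eq_or_ne θ 0 with rfl | hθ
  · simp
  have hmeas : Measurable fun A : Finset V => I.hitProb A x := .of_discrete
  have htail := measureReal_sum_ge_le_exp (s := Finset.range θ)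
    (M := θ * (M / Fintype.card V)) (a := θ * (a / Fintype.card V))
    (hR.iIndepFun.comp (fun _ A => I.hitProb A x) fun _ => hmeas)
    (fun i => (hmeas.comp (hR.measurable i)).aemeasurable)
    (fun i => .of_forall fun ω => hitProb_mem_Icc hx (R i ω))
    ((sum_integral_hitProb hR θ).trans_le (by gcongr)) (by positivity) (by positivity)
  calc μ.real {ω | I.g x + a ≤ I.gHat (fun i => R i ω) θ x} ≤ _ := by
        refine measureReal_mono fun ω hω => ?_
        simp only [Function.comp_apply, Set.mem_ofPred_eq, sum_integral_hitProb hR,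
          sum_hitProb_eq (R := fun i => R i ω) hθ, ← mul_add, ← add_div] at hω ⊢
        gcongr
    _ ≤ _ := htail
    _ = _ := by
        congr 2
        field_simp

theorem measureReal_gHat_le_g_sub_le_exp (hR : I.model.IsRRSequence μ R) (hx : ∀ j, 0 ≤ x j)
    (hgM : I.g x ≤ M) (hM : 0 < M) (ha : 0 < a) (θ : ℕ) :
    μ.real {ω | I.gHat (fun i => R i ω) θ x ≤ I.g x - a} ≤
      Real.exp (-(θ * (a ^ 2 / ((Fintype.card V : ℝ) * (2 * M))))) := by
  rcases eq_or_ne θ 0 with rfl | hθ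
  · simp
  have hmeas : Measurable fun A : Finset V => I.hitProb A x := .of_discrete
  have htail := measureReal_sum_le_le_exp (s := Finset.range θ)
    (M := θ * (M / Fintype.card V)) (a := θ * (a / Fintype.card V))
    (hR.iIndepFun.comp (fun _ A => I.hitProb A x) fun _ => hmeas)
    (fun i => (hmeas.comp (hR.measurable i)).aemeasurable)
    (fun i => .of_forall fun ω => hitProb_mem_Icc hx (R i ω))
    ((sum_integral_hitProb hR θ).trans_le (by gcongr)) (by positivity) (by positivity)
  calc μ.real {ω | I.gHat (fun i => R i ω) θ x ≤ I.g x - a} ≤ _ := by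
        refine measureReal_mono fun ω hω => ?_
        simp only [Function.comp_apply, Set.mem_ofPred_eq, sum_integral_hitProb hR,
          sum_hitProb_eq (R := fun i => R i ω) hθ, ← mul_sub, ← sub_div] at hω ⊢
        gcongr
    _ ≤ _ := htail
    _ = _ := by
        congr 2
        field_simp

theorem measureReal_exists_mem_net_le (hR : I.model.IsRRSequence μ R)
    {C : Finset (EuclideanSpace ℝ (Fin d))} (hC : ∀ z ∈ C, z ∈ I.feasible) {N K : ℝ}
    (hcard : (C.card : ℝ) ≤ N) (hN : 0 < N) (hK : 0 < K) (hM : 0 < M) (ha : 0 < a) {θ : ℕ}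
    (hθ : Real.log (N * K) ≤
      θ * (a ^ 2 / ((Fintype.card V : ℝ) * (2 * M + 2 / 3 * a)))) :
    μ.real {ω | ∃ z ∈ C, I.g z ≤ M ∧ I.g z + a ≤ I.gHat (fun i => R i ω) θ z} ≤ 1 / K := by
  have htail : ∀ z ∈ C, μ.real {ω | I.g z ≤ M ∧ I.g z + a ≤ I.gHat (fun i => R i ω) θ z} ≤
      1 / (N * K) := fun z hz => by
    by_cases hgM : I.g z ≤ M
    · simp only [hgM, true_and]
      exact (measureReal_g_add_le_gHat_le_exp hR (nonneg_of_mem_feasible (hC z hz)) hgM hM ha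
        θ).trans (exp_neg_le_one_div (by positivity) hθ)
    · simp only [hgM, false_and]
      simpa using by positivity
  calc _ ≤ μ.real (⋃ z ∈ C, {ω | I.g z ≤ M ∧ I.g z + a ≤ I.gHat (fun i => R i ω) θ z}) := by
        exact measureReal_mono (fun ω ⟨z, hz, h⟩ => Set.mem_biUnion hz h) (measure_ne_top _ _)
    _ ≤ ∑ z ∈ C, μ.real {ω | I.g z ≤ M ∧ I.g z + a ≤ I.gHat (fun i => R i ω) θ z} :=
        measureReal_biUnion_finset_le _ _
    _ ≤ C.card * (1 / (N * K)) := by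
        rw [← nsmul_eq_mul]
        exact Finset.sum_le_card_nsmul _ _ _ htail
    _ ≤ N * (1 / (N * K)) := by gcongr
    _ = 1 / K := by field_simp

theorem measureReal_le_roundValue_le (hclosed : IsClosed I.feasible) (hp : p.Valid I)
    (hlip : 0 < lip I p) (hR : I.model.IsRRSequence μ R)
    (hlog : 0 < Real.logb 2 ((Fintype.card V : ℝ) + I.lam * I.budget)) (i : ℕ) :
    μ.real {ω | (1 + epsPrime p + p.ε / 3) * max (I.guess i) I.opt ≤
        roundValue I p (fun j => R j ω) i} ≤
      1 / ((Fintype.card V : ℝ) ^ p.ℓ * 2 *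
        Real.logb 2 ((Fintype.card V : ℝ) + I.lam * I.budget)) := by
  have hε := hp.ε_pos
  have hguess := guess_pos I i
  have hM : 0 < max (I.guess i) I.opt := lt_max_of_lt_left hguess
  have hr : 0 < p.ε / 3 / lip I p * I.guess i := by positivity
  obtain ⟨C, hCI, hcard, hC⟩ := exists_net hclosed hp hr
  refine (measureReal_mono fun ω hω => ?_).trans (measureReal_exists_mem_net_le hR hCI hcard
    (one_pos.trans_le (one_le_covering hclosed hp hr)) (by positivity) hM
    (mul_pos (epsPrime_pos hε) hM)
    (log_covering_mul_le_theta_mul hclosed hp hlip hlog (le_max_left _ _)))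
  obtain ⟨z, hz, hgHat⟩ := exists_mem_net_of_le_roundValue hclosed hp hlip hCI hC
    (le_max_left _ _) (le_max_right _ _) hω
  have hzopt := le_opt hclosed hp (hCI z hz)
  have hsz := s_nonneg (hCI z hz)
  exact ⟨z, hz, le_max_of_le_right (by linarith), hgHat⟩

theorem measureReal_opt_lt_lowerBound_le (hclosed : IsClosed I.feasible) (hopt : 1 ≤ I.opt)
    (hp : p.Valid I) (hlip : 0 < lip I p) (hR : I.model.IsRRSequence μ R) :
    μ.real {ω | I.opt < lowerBound I p fun i => R i ω} ≤
      1 / (2 * (Fintype.card V : ℝ) ^ p.ℓ) := by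
  set W := Real.logb 2 ((Fintype.card V : ℝ) + I.lam * I.budget)
  have hunion : {ω | I.opt < lowerBound I p fun i => R i ω} ⊆
      ⋃ i ∈ Finset.Ico 1 (1 + ⌊W - 1⌋₊), {ω | (1 + epsPrime p + p.ε / 3) *
        max (I.guess i) I.opt ≤ roundValue I p (fun j => R j ω) i} := fun ω hω => by
    obtain ⟨i, hi, hround⟩ := exists_round_of_lt_samplingLoop hp.ε_pos hopt hω
    exact Set.mem_biUnion hi hround
  rcases le_or_gt W 0 with hW0 | hW0
  · rw [Nat.floor_of_nonpos (by linarith), add_zero, Finset.Ico_self] at hunion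
    rw [Set.subset_eq_empty hunion (by simp), measureReal_empty]
    positivity
  have hfloor : (⌊W - 1⌋₊ : ℝ) ≤ W :=
    (Nat.cast_le.2 (Nat.floor_le_floor (by linarith))).trans (Nat.floor_le hW0.le)
  calc _ ≤ ∑ i ∈ Finset.Ico 1 (1 + ⌊W - 1⌋₊), μ.real {ω | (1 + epsPrime p + p.ε / 3) *
        max (I.guess i) I.opt ≤ roundValue I p (fun j => R j ω) i} :=
        (measureReal_mono hunion (measure_ne_top _ _)).trans (measureReal_biUnion_finset_le _ _)
    _ ≤ ⌊W - 1⌋₊ * (1 / ((Fintype.card V : ℝ) ^ p.ℓ * 2 * W)) := by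
        refine (Finset.sum_le_card_nsmul _ _ _ fun i _ =>
          measureReal_le_roundValue_le hclosed hp hlip hR hW0 i).trans_eq ?_
        rw [nsmul_eq_mul, Nat.card_Ico, Nat.add_sub_cancel_left]
    _ ≤ W * (1 / ((Fintype.card V : ℝ) ^ p.ℓ * 2 * W)) := by
        gcongr
    _ = 1 / (2 * (Fintype.card V : ℝ) ^ p.ℓ) := by field_simp

theorem measureReal_upperGrad_lt_le (hclosed : IsClosed I.feasible) (hp : p.Valid I)
    (hlip : 0 < lip I p) (hratio : p.ε < ratio) (hR : I.model.IsRRSequence μ R) {b : ℝ}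
    (hb : 0 < b) (hbopt : b ≤ I.opt) :
    μ.real {ω | I.g (upperGrad I p (fun i => R i ω) (thetaFinal I p b) (p.ε * b)) +
        I.s (upperGrad I p (fun i => R i ω) (thetaFinal I p b) (p.ε * b)) <
          (ratio - p.ε) * I.opt} ≤
      1 / (2 * (Fintype.card V : ℝ) ^ p.ℓ) := by
  have hε := hp.ε_pos
  have hopt : 0 < I.opt := hb.trans_le hbopt
  have hratio' : 0 < ratio - p.ε / 3 := by linarith
  have hr : 0 < p.ε / 3 / (lip I p + lip I p) * b := by positivity
  obtain ⟨y, hy, hyopt⟩ := exists_opt_eq hclosed hp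
  obtain ⟨C, hCI, hcard, hC⟩ := exists_net hclosed hp hr
  have hlow := (measureReal_gHat_le_g_sub_le_exp hR (nonneg_of_mem_feasible hy)
    (a := (ratio - p.ε / 3) * p.ε / 6 * I.opt) (by linarith [s_nonneg hy]) hopt (by positivity)
    (thetaFinal I p b)).trans
      (exp_neg_le_one_div (by positivity) (log_le_thetaFinal_mul hε hratio hb hbopt))
  have hhigh := measureReal_exists_mem_net_le hR hCI hcard
    (one_pos.trans_le (one_le_covering hclosed hp hr)) (by positivity)
    (mul_pos (by linarith) hopt) (by positivity)
    (log_covering_mul_le_thetaFinal_mul hε hratio hb hbopt)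
  calc _ ≤ _ := measureReal_mono fun ω hω => or_iff_not_imp_left.2 fun hlow =>
        exists_mem_net_of_lt hp hlip hbopt hCI hC (upperGrad_mem_feasible hclosed hp.x₀_mem ..)
          (ratio_sub_mul_opt_le_of_lt_gHat hclosed hp hb hbopt hy hyopt (not_le.1 hlow)) hω
    _ ≤ 1 / (4 * (Fintype.card V : ℝ) ^ p.ℓ) + 1 / (4 * (Fintype.card V : ℝ) ^ p.ℓ) :=
        (measureReal_union_le _ _).trans (add_le_add hlow hhigh)
    _ = 1 / (2 * (Fintype.card V : ℝ) ^ p.ℓ) := by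
        field_simp
        norm_num

end Estimation

section Dependence

variable {V : Type*} [Fintype V] {d : ℕ} (I : CIMBS V d) (p : Input V d) (θ : ℕ)

theorem dependsOn_lipBar : DependsOn (fun R => lipBar I p R θ) (Set.Iio θ) := fun R R' h => by
  simp only [lipBar, avgSize]
  rw [Finset.sum_congr rfl fun i hi => by rw [h i (Finset.mem_range.1 hi)]]

theorem dependsOn_gHat : DependsOn (fun R => I.gHat R θ) (Set.Iio θ) := fun R R' h => by
  funext x
  simp only [gHat]
  rw [Finset.sum_congr rfl fun i hi => by rw [h i (Finset.mem_range.1 hi)]]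

theorem dependsOn_gBar : DependsOn (fun R => I.gBar R θ) (Set.Iio θ) := fun R R' h => by
  funext x
  simp only [gBar]
  rw [Finset.sum_congr rfl fun i hi => by rw [h i (Finset.mem_range.1 hi)]]

theorem dependsOn_subgrad : DependsOn (fun R => subgrad I p R θ) (Set.Iio θ) := fun R R' h => by
  funext x
  simp only [subgrad]
  rw [Finset.sum_congr rfl fun i hi => by rw [h i (Finset.mem_range.1 hi)]]

theorem dependsOn_iterate (t : ℕ) : DependsOn (fun R => iterate I p R θ t) (Set.Iio θ) :=
  fun R R' h => by
    induction t with
    | zero => rfl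
    | succ t ih =>
      simp only [iterate, ih, dependsOn_lipBar I p θ h, dependsOn_subgrad I p θ h]

theorem dependsOn_best (t : ℕ) : DependsOn (fun R => best I p R θ t) (Set.Iio θ) :=
  fun R R' h => by
    induction t with
    | zero => rfl
    | succ t ih => simp only [best, ih, dependsOn_gBar I θ h, dependsOn_iterate I p θ _ h]

theorem dependsOn_upperGrad (δ : ℝ) : DependsOn (fun R => upperGrad I p R θ δ) (Set.Iio θ) :=
  fun R R' h => by
    simp only [upperGrad, dependsOn_lipBar I p θ h, dependsOn_best I p θ _ h]

theorem dependsOn_roundValue (i : ℕ) :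
    DependsOn (fun R => roundValue I p R i) (Set.Iio (theta I p i)) := fun R R' h => by
  simp only [roundValue, dependsOn_gHat I _ h, dependsOn_upperGrad I p _ _ h]

theorem dependsOn_samplingLoop (m i : ℕ) :
    DependsOn (fun R => samplingLoop I p R m i) (⋃ j ∈ Set.Iio (i + m), Set.Iio (theta I p j)) :=
  fun R R' h => by
    induction m generalizing i with
    | zero => rfl
    | succ m ih =>
      have hround : roundValue I p R i = roundValue I p R' i := dependsOn_roundValue I p i
        fun k hk => h k (Set.mem_biUnion (show i < i + (m + 1) by omega) hk)
      rw [← add_assoc, add_right_comm] at h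
      simp only [samplingLoop, hround, ih (i + 1) h]

theorem exists_finite_dependsOn_lowerBound :
    ∃ s : Set ℕ, s.Finite ∧ DependsOn (fun R => lowerBound I p R) s :=
  ⟨_, (Set.finite_Iio _).biUnion fun _ _ => Set.finite_Iio _, dependsOn_samplingLoop I p _ _⟩

end Dependence

section Final

variable {V : Type*} [Fintype V] [Nonempty V] {d : ℕ} {I : CIMBS V d} {p : Input V d}
  {Ω : Type*} [MeasurableSpace Ω] {μ : Measure Ω} [IsProbabilityMeasure μ]
  {R R' : ℕ → Ω → Finset V}

theorem measureReal_upperGradRIS_lt_le (hclosed : IsClosed I.feasible) (hp : p.Valid I)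
    (hlip : 0 < lip I p) (hratio : p.ε < ratio) (hR : ∀ i, Measurable (R i))
    (hR' : I.model.IsRRSequence μ R')
    (hindep : IndepFun (fun ω i => R i ω) (fun ω i => R' i ω) μ) :
    μ.real {ω | lowerBound I p (fun i => R i ω) ≤ I.opt ∧
        I.g (upperGradRIS I p (fun i => R i ω) fun i => R' i ω) +
          I.s (upperGradRIS I p (fun i => R i ω) fun i => R' i ω) < (ratio - p.ε) * I.opt} ≤
      1 / (2 * (Fintype.card V : ℝ) ^ p.ℓ) := by
  obtain ⟨s, hs, hdep⟩ := exists_finite_dependsOn_lowerBound I p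
  have hLB : Measurable fun A => lowerBound I p A := measurable_of_dependsOn hs hdep
  let value (b : ℝ) (A : ℕ → Finset V) : ℝ :=
    I.g (upperGrad I p A (thetaFinal I p b) (p.ε * b)) +
      I.s (upperGrad I p A (thetaFinal I p b) (p.ε * b))
  have hvalue (b : ℝ) : Measurable (value b) :=
    measurable_of_dependsOn (Set.finite_Iio (thetaFinal I p b)) fun A A' h => by
      simp only [value, dependsOn_upperGrad I p _ _ h]
  refine (measureReal_mono fun ω hω => ?_).trans (measureReal_mem_and_mem_le_of_indepFun
    (S := Set.Ioc 0 I.opt) (B := fun b => {A | value b A < (ratio - p.ε) * I.opt})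
    (hindep.comp hLB measurable_id) (hLB.comp (measurable_pi_lambda _ hR))
    ((finite_range_of_dependsOn hs hdep).subset (Set.range_comp_subset_range _ _))
    (fun b => measurableSet_lt (hvalue b) measurable_const) (by positivity)
    fun b hb => measureReal_upperGrad_lt_le hclosed hp hlip hratio hR' hb.1 hb.2)
  exact ⟨⟨samplingLoop_pos hp.ε_pos _ _, hω.1⟩, hω.2⟩

theorem ratio_sub_mul_opt_le (hclosed : IsClosed I.feasible) (hopt : 0 ≤ I.opt) (hp : p.Valid I)
    (h : ¬(0 < lip I p ∧ p.ε < ratio)) {x : EuclideanSpace ℝ (Fin d)} (hx : x ∈ I.feasible) :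
    (ratio - p.ε) * I.opt ≤ I.g x + I.s x := by
  obtain hlip | hratio := not_and_or.1 h
  · obtain ⟨y, hy, hyopt⟩ := exists_opt_eq hclosed hp
    have hsub := g_add_s_sub_le hp hy hx
    rw [le_antisymm (not_lt.1 hlip) (lip_nonneg I p), zero_mul] at hsub
    have hle : (ratio - p.ε) * I.opt ≤ 1 * I.opt := by
      gcongr
      linarith [ratio_le_two_thirds, hp.ε_pos]
    linarith
  · exact (mul_nonpos_of_nonpos_of_nonneg (by linarith) hopt).trans
      (add_nonneg (g_nonneg (nonneg_of_mem_feasible hx)) (s_nonneg hx))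

theorem measureReal_upperGradRIS_lt_le_one_div (hclosed : IsClosed I.feasible)
    (hopt : 1 ≤ I.opt) (hp : p.Valid I) (hR : I.model.IsRRSequence μ R)
    (hR' : I.model.IsRRSequence μ R')
    (hindep : IndepFun (fun ω i => R i ω) (fun ω i => R' i ω) μ) :
    μ.real {ω | I.g (upperGradRIS I p (fun i => R i ω) fun i => R' i ω) +
        I.s (upperGradRIS I p (fun i => R i ω) fun i => R' i ω) < (ratio - p.ε) * I.opt} ≤
      1 / (Fintype.card V : ℝ) ^ p.ℓ := by
  by_cases h : 0 < lip I p ∧ p.ε < ratio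
  · calc _ ≤ _ := measureReal_mono fun ω hω => (lt_or_ge _ _).imp_right fun hle => ⟨hle, hω⟩
      _ ≤ 1 / (2 * (Fintype.card V : ℝ) ^ p.ℓ) + 1 / (2 * (Fintype.card V : ℝ) ^ p.ℓ) :=
          (measureReal_union_le _ _).trans (add_le_add
            (measureReal_opt_lt_lowerBound_le hclosed hopt hp h.1 hR)
            (measureReal_upperGradRIS_lt_le hclosed hp h.1 h.2 hR.measurable hR' hindep))
      _ = 1 / (Fintype.card V : ℝ) ^ p.ℓ := by
          field_simp
          norm_num
  · have hempty : {ω | I.g (upperGradRIS I p (fun i => R i ω) fun i => R' i ω) +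
        I.s (upperGradRIS I p (fun i => R i ω) fun i => R' i ω) < (ratio - p.ε) * I.opt} = ∅ :=
      Set.eq_empty_of_forall_notMem fun ω => not_lt.2 <| ratio_sub_mul_opt_le hclosed
        (one_pos.le.trans hopt) hp h (upperGrad_mem_feasible hclosed hp.x₀_mem ..)
    rw [hempty, measureReal_empty]
    positivity

end Final

end CIMBS

theorem theorem4 {V : Type*} [Fintype V] [Nonempty V] {d : ℕ} (I : CIMBS V d)
    (hclosed : IsClosed I.feasible) (hopt : 1 ≤ I.opt)
    (p : CIMBS.Input V d) (hp : p.Valid I)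
    {Ω : Type*} [MeasurableSpace Ω] (μ : Measure Ω) [IsProbabilityMeasure μ]
    (R R' : ℕ → Ω → Finset V)
    (hR : ∀ i, Measurable (R i)) (hR' : ∀ i, Measurable (R' i))
    (hlaw : ∀ i, μ.map (R i) = I.model.rrLaw.toMeasure)
    (hlaw' : ∀ i, μ.map (R' i) = I.model.rrLaw.toMeasure)
    (hindep : iIndepFun (fun i : ℕ ⊕ ℕ => Sum.elim R R' i) μ) :
    1 - 1 / (Fintype.card V : ℝ) ^ p.ℓ ≤
      μ.real {ω | I.upperGradRIS p (fun i => R i ω) (fun i => R' i ω) ∈ I.feasible ∧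
        (1 - 1 / Real.exp 1 - p.ε) * I.opt ≤
          I.g (I.upperGradRIS p (fun i => R i ω) (fun i => R' i ω)) +
            I.s (I.upperGradRIS p (fun i => R i ω) (fun i => R' i ω))} := by
  have hRR : I.model.IsRRSequence μ R :=
    ⟨hR, hlaw, iIndepFun.precomp (g := Sum.inl) Sum.inl_injective hindep⟩
  have hRR' : I.model.IsRRSequence μ R' :=
    ⟨hR', hlaw', iIndepFun.precomp (g := Sum.inr) Sum.inr_injective hindep⟩
  have hfail := CIMBS.measureReal_upperGradRIS_lt_le_one_div hclosed hopt hp hRR hRR'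
    (indepFun_of_iIndepFun_sumElim hR hR' hindep)
  refine one_sub_le_measureReal_of_compl_le ((measureReal_mono fun ω hω => ?_).trans hfail)
  exact not_le.1 fun hle => hω ⟨CIMBS.upperGrad_mem_feasible hclosed hp.x₀_mem .., hle⟩
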